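/- Let $X$ be a complex Hilbert space, $L^2 := L^2([-1,0],X)$ and $W^{1,2} := W^{1,2}([-1,0],X)$ with its usual norm (every $f\in W^{1,2}$ is identified with its continuous representative). Let $\Phi : W^{1,2}\to X$ be a bounded linear operator (the delay operator of the equation $u'(t)=Bu(t)+\Phi u_t$). For a linear operator $B:D(B)\subseteq X\to X$ consider on the Hilbert space $\mathcal E := X\times L^2$ the operator $$\mathcal A\begin{pmatrix}x\\ f\end{pmatrix} := \begin{pmatrix}Bx+\Phi f\\ f'\end{pmatrix},\qquad D(\mathcal A) := \left\{\begin{pmatrix}x\\ f\end{pmatrix}\in D(B)\times W^{1,2} : f(0)=x\right\}.$$ Let $A_0 f := f'$ with $D(A_0) := \{f\in W^{1,2}: f(0)=0\}$ be the generator of the nilpotent left shift semigroup on $L^2$, and for $\lambda\in\mathbb C$ define $\Phi_\lambda\in\mathcal L(X)$ by $\Phi_\lambda x := \Phi(e^{\lambda\,\cdot}x)$. Write $R(\lambda,G)=(\lambda-G)^{-1}$ for the resolvent of $G$, and, for the generator $G$ of a strongly continuous semigroup $(T(t))_{t\ge 0}$, let $$\omega_0(G) := \inf\{w\in\mathbb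 R : \exists M\ \forall t\ge 0\ \ \|T(t)\|\le Me^{wt}\}\in[-\infty,\infty)$$ be its growth bound. Call $\Phi$ admissible if (a) $\mathcal A$ generates a strongly continuous semigroup on $\mathcal E$ for every $B$ that generates a strongly continuous semigroup on $X$, and (b) for every $w\in\mathbb R$ the function $\lambda\mapsto\Phi R(\lambda,A_0)\in\mathcal L(L^2,X)$ is bounded and analytic on $\{\lambda\in\mathbb C:\operatorname{Re}\lambda>w\}$. Assume that $\Phi$ is admissible, that $B$ generates a strongly continuous semigroup on $X$ with $\omega_0(B)<0$, and let $\alpha\in\mathbb R$ with $\omega_0(B)<\alpha\le 0$. If $$\sup_{\omega\in\mathbb R}\|\Phi_{\alpha+i\omega}R(\alpha+i\omega,B)\|<1,$$ then $\mathcal A$ generates a strongly continuous semigroup and $\omega_0(\mathcal A)<\alpha\le 0$. The same conclusion holds in particular if $$\sup_{\omega\in\mathbb R}\|\Phi_{\alpha+i\omega}\|<\frac{1}{\sup_{\omega\in\mathbb R}\|R(\alpha+i\omega,B)\|}$$ (with $1/0:=\infty$). -/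

import Mathlib

open MeasureTheory Set Filter Topology

noncomputable section

set_option linter.unusedSectionVars false

namespace DelayEquation

section Semigroups

variable {E : Type*} [NormedAddCommGroup E] [NormedSpace ℂ E]

/-- `T` (restricted to `t ≥ 0`) is a strongly continuous semigroup of bounded operators on `E`.
The values `T t` for `t < 0` play no role. -/
structure IsC0Semigroup (T : ℝ → E →L[ℂ] E) : Prop where
  map_zero : T 0 = ContinuousLinearMap.id ℂ E
  map_add : ∀ s t : ℝ, 0 ≤ s → 0 ≤ t → T (s + t) = (T s).comp (T t)
  continuousOn : ∀ x : E, ContinuousOn (fun t : ℝ => T t x) (Ici 0)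

/-- `A` is the infinitesimal generator of `T`: `x ∈ D(A)` and `A x = y` if and only if
`(T t x - x) / t` tends to `y` as `t` decreases to `0`. -/
def Generates (A : E →ₗ.[ℂ] E) (T : ℝ → E →L[ℂ] E) : Prop :=
  ∀ x y : E, (x, y) ∈ A.graph ↔
    Tendsto (fun t : ℝ => ((t⁻¹ : ℝ) : ℂ) • (T t x - x)) (𝓝[>] 0) (𝓝 y)

/-- `A` generates a strongly continuous semigroup. -/
def IsGenerator (A : E →ₗ.[ℂ] E) : Prop :=
  ∃ T : ℝ → E →L[ℂ] E, IsC0Semigroup T ∧ Generates A T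

/-- The growth bound `ω₀(A)` of the strongly continuous semigroup `T` generated by `A`:
the infimum in `[-∞, ∞]` of all real `w` such that `‖T t‖ ≤ M e ^ (w t)` for all `t ≥ 0`, for
some `M`.  (It is `⊤` if `A` is not a generator.) -/
def growthBound (A : E →ₗ.[ℂ] E) : EReal :=
  sInf {v : EReal | ∃ w : ℝ, v = (w : EReal) ∧ ∃ T : ℝ → E →L[ℂ] E,
    IsC0Semigroup T ∧ Generates A T ∧
      ∃ M : ℝ, ∀ t : ℝ, 0 ≤ t → ‖T t‖ ≤ M * Real.exp (w * t)}

/-- `R` is a bounded two-sided inverse of `l - A : D(A) → E`. -/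
def IsResolventAt (A : E →ₗ.[ℂ] E) (l : ℂ) (R : E →L[ℂ] E) : Prop :=
  (∀ y : E, ∃ h : R y ∈ A.domain, l • R y - A ⟨R y, h⟩ = y) ∧
    ∀ x : A.domain, R (l • (x : E) - A x) = x

/-- The resolvent set `ρ(A)`. -/
def resolventSet (A : E →ₗ.[ℂ] E) : Set ℂ :=
  {l | ∃ R : E →L[ℂ] E, IsResolventAt A l R}

open Classical in
/-- The resolvent operator `R(l, A) = (l - A)⁻¹` for `l ∈ ρ(A)` (and `0` for other `l`). -/
def resolvent (A : E →ₗ.[ℂ] E) (l : ℂ) : E →L[ℂ] E :=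
  if h : l ∈ resolventSet A then Classical.choose h else 0

end Semigroups

section Sobolev

/-- Lebesgue measure on `[-1, 0]`. -/
abbrev mu : Measure ℝ := volume.restrict (Icc (-1 : ℝ) 0)

variable (X : Type*) [NormedAddCommGroup X] [NormedSpace ℂ X] [CompleteSpace X]

/-- The history space `L²([-1, 0], X)`. -/
abbrev History : Type _ := Lp X 2 mu

variable {X}

/-- `f` is (a.e. equal to) the absolutely continuous function with value `c` at `0` and
derivative `g`: `f(σ) = c + ∫_0^σ g(s) ds` for a.e. `σ ∈ [-1, 0]`. -/
def IsPrimitive (c : X) (f g : History X) : Prop :=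
  ∀ᵐ σ ∂mu, f σ = c + ∫ s in (0 : ℝ)..σ, g s

lemma intervalIntegrable_coe (g : History X) : IntervalIntegrable g volume (-1) 0 := by
  have h : Integrable g mu := (Lp.memLp g).integrable (by norm_num)
  rw [intervalIntegrable_iff_integrableOn_Icc_of_le (by norm_num)]
  exact h

lemma intervalIntegrable_coe_of_mem (g : History X) {σ : ℝ} (hσ : σ ∈ Icc (-1 : ℝ) 0) :
    IntervalIntegrable g volume 0 σ := by
  refine (intervalIntegrable_coe g).mono_set ?_
  rw [uIcc_of_ge hσ.2, uIcc_of_le (by norm_num)]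
  exact Icc_subset_Icc_left hσ.1

lemma ae_mem_mu : ∀ᵐ σ ∂mu, σ ∈ Icc (-1 : ℝ) 0 := ae_restrict_mem measurableSet_Icc

lemma IsPrimitive.add {c c' : X} {f g f' g' : History X} (h : IsPrimitive c f g)
    (h' : IsPrimitive c' f' g') : IsPrimitive (c + c') (f + f') (g + g') := by
  have hg := ae_imp_of_ae_restrict (Lp.coeFn_add g g')
  filter_upwards [h, h', Lp.coeFn_add f f', ae_mem_mu] with σ h1 h2 h3 hσ
  have e : ∫ s in (0 : ℝ)..σ, (g + g' : History X) s = ∫ s in (0 : ℝ)..σ, (g s + g' s) := by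
    refine intervalIntegral.integral_congr_ae ?_
    filter_upwards [hg] with s hs hs'
    rw [uIoc_of_ge hσ.2] at hs'
    exact hs ⟨hσ.1.trans hs'.1.le, hs'.2⟩
  rw [e, intervalIntegral.integral_add (intervalIntegrable_coe_of_mem g hσ)
    (intervalIntegrable_coe_of_mem g' hσ), h3, Pi.add_apply, h1, h2]
  abel

lemma IsPrimitive.smul {c : X} {f g : History X} (a : ℂ) (h : IsPrimitive c f g) :
    IsPrimitive (a • c) (a • f) (a • g) := by
  have hg := ae_imp_of_ae_restrict (Lp.coeFn_smul a g)
  filter_upwards [h, Lp.coeFn_smul a f, ae_mem_mu] with σ h1 h3 hσ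
  have e : ∫ s in (0 : ℝ)..σ, (a • g : History X) s = ∫ s in (0 : ℝ)..σ, a • g s := by
    refine intervalIntegral.integral_congr_ae ?_
    filter_upwards [hg] with s hs hs'
    rw [uIoc_of_ge hσ.2] at hs'
    exact hs ⟨hσ.1.trans hs'.1.le, hs'.2⟩
  rw [e, intervalIntegral.integral_smul, h3, Pi.smul_apply, h1, smul_add]

lemma isPrimitive_zero : IsPrimitive (0 : X) (0 : History X) 0 := by
  have h := IsPrimitive.smul (c := (0 : X)) (f := 0) (g := 0) 0
  have hg := ae_imp_of_ae_restrict (Lp.coeFn_zero X 2 mu)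
  filter_upwards [Lp.coeFn_zero X 2 mu, ae_mem_mu] with σ h3 hσ
  have e : ∫ s in (0 : ℝ)..σ, (0 : History X) s = ∫ s in (0 : ℝ)..σ, (0 : X) := by
    refine intervalIntegral.integral_congr_ae ?_
    filter_upwards [hg] with s hs hs'
    rw [uIoc_of_ge hσ.2] at hs'
    exact hs ⟨hσ.1.trans hs'.1.le, hs'.2⟩
  rw [e, h3]
  simp

/-- The value at `0` and the derivative of an absolutely continuous function are unique. -/
lemma IsPrimitive.unique {c c' : X} {f g g' : History X} (h : IsPrimitive c f g)
    (h' : IsPrimitive c' f g') : c = c' ∧ g = g' := by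
  have hk := h.add (h'.smul (-1))
  have cont : ∀ u : History X, ContinuousOn (fun σ => ∫ s in (0 : ℝ)..σ, u s)
      (Icc (-1 : ℝ) 0) := by
    intro u
    have := intervalIntegral.continuousOn_primitive_interval' (intervalIntegrable_coe u)
      (a := 0) (by simp [uIcc_of_le])
    rwa [uIcc_of_le (by norm_num)] at this
  have key : EqOn (fun σ => c + ∫ s in (0 : ℝ)..σ, g s) (fun σ => c' + ∫ s in (0 : ℝ)..σ, g' s)
      (Icc (-1 : ℝ) 0) := by
    refine Measure.eqOn_Icc_of_ae_eq volume (by norm_num) ?_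
      (continuousOn_const.add (cont g)) (continuousOn_const.add (cont g'))
    filter_upwards [h, h'] with σ h1 h2
    rw [← h1, ← h2]
  have hc : c = c' := by simpa using key (x := 0) (by simp)
  refine ⟨hc, ?_⟩
  subst hc
  refine Lp.ext ?_
  have d := IntervalIntegrable.ae_hasDerivAt_integral (intervalIntegrable_coe g)
  have d' := IntervalIntegrable.ae_hasDerivAt_integral (intervalIntegrable_coe g')
  rw [uIcc_of_le (by norm_num)] at d d'
  have hne : ∀ᵐ x : ℝ, x ≠ -1 ∧ x ≠ 0 := by
    rw [eventually_and]
    constructor <;> simp [ae_iff, measure_singleton]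
  refine (ae_restrict_iff' measurableSet_Icc).2 ?_
  filter_upwards [d, d', hne] with x hx hx' hxn hxm
  have e1 := hx hxm 0 (by simp)
  have e2 := hx' hxm 0 (by simp)
  refine e1.unique (e2.congr_of_eventuallyEq ?_)
  have hm : Ioo (-1 : ℝ) 0 ∈ 𝓝 x :=
    Ioo_mem_nhds (lt_of_le_of_ne hxm.1 (Ne.symm hxn.1)) (lt_of_le_of_ne hxm.2 hxn.2)
  filter_upwards [hm] with y hy
  simpa using key (Ioo_subset_Icc_self hy)

variable (X)

/-- The Sobolev space `W^{1,2}([-1, 0], X)` of functions with absolutely continuous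
representative and derivative in `L²`, realized as the space of pairs `(f, f')` in
`L² × L²`, with the norm `(‖f‖² + ‖f'‖²)^{1/2}`. -/
def W12 : Submodule ℂ (WithLp 2 (History X × History X)) where
  carrier := {p | ∃ c : X, IsPrimitive c p.fst p.snd}
  add_mem' := by
    rintro p q ⟨c, hc⟩ ⟨d, hd⟩
    exact ⟨c + d, hc.add hd⟩
  zero_mem' := ⟨0, isPrimitive_zero⟩
  smul_mem' := by
    rintro a p ⟨c, hc⟩
    exact ⟨a • c, hc.smul a⟩

variable {X}

/-- The inclusion `W^{1,2} → L²`. -/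
def toHistory : W12 X →ₗ[ℂ] History X where
  toFun u := (u : WithLp 2 (History X × History X)).fst
  map_add' _ _ := rfl
  map_smul' _ _ := rfl

/-- The derivative `d/dσ : W^{1,2} → L²`. -/
def derivative : W12 X →ₗ[ℂ] History X where
  toFun u := (u : WithLp 2 (History X × History X)).snd
  map_add' _ _ := rfl
  map_smul' _ _ := rfl

lemma exists_isPrimitive (u : W12 X) : ∃ c : X, IsPrimitive c (toHistory u) (derivative u) :=
  u.2

lemma toHistory_injective : Function.Injective (toHistory : W12 X → History X) := by
  intro u v h
  obtain ⟨c, hc⟩ := exists_isPrimitive u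
  obtain ⟨d, hd⟩ := exists_isPrimitive v
  rw [← h] at hd
  have hg := (hc.unique hd).2
  apply Subtype.ext
  apply WithLp.ofLp_injective
  exact Prod.ext h hg

/-- The value at `0` of (the continuous representative of) `u ∈ W^{1,2}`. -/
def atZero : W12 X →ₗ[ℂ] X where
  toFun u := Classical.choose (exists_isPrimitive u)
  map_add' u v := by
    refine (Classical.choose_spec (exists_isPrimitive (u + v))).unique (g' := derivative (u + v)) ?_ |>.1
    rw [map_add, map_add]
    exact (Classical.choose_spec (exists_isPrimitive u)).add
      (Classical.choose_spec (exists_isPrimitive v))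
  map_smul' a u := by
    refine (Classical.choose_spec (exists_isPrimitive (a • u))).unique (g' := derivative (a • u)) ?_ |>.1
    rw [map_smul, map_smul]
    exact (Classical.choose_spec (exists_isPrimitive u)).smul a

lemma isPrimitive_atZero (u : W12 X) : IsPrimitive (atZero u) (toHistory u) (derivative u) :=
  Classical.choose_spec (exists_isPrimitive u)

/-- `W^{1,2}` is identified with a linear subspace of `L²`. -/
def toHistoryEquiv : W12 X ≃ₗ[ℂ] LinearMap.range (toHistory : W12 X →ₗ[ℂ] History X) :=
  LinearEquiv.ofInjective toHistory toHistory_injective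

end Sobolev

section Delay

variable {X : Type*} [NormedAddCommGroup X] [NormedSpace ℂ X] [CompleteSpace X]

/-- The state space `ℰ = X × L²([-1, 0], X)` with the `2`-product norm. -/
abbrev StateSpace (X : Type*) [NormedAddCommGroup X] [NormedSpace ℂ X] : Type _ :=
  WithLp 2 (X × History X)

/-- The domain `{(x, f) ∈ D(B) × W^{1,2} : f(0) = x}` of the delay operator matrix. -/
def delayDomain (B : X →ₗ.[ℂ] X) : Submodule ℂ (StateSpace X) where
  carrier := {p | p.fst ∈ B.domain ∧ ∃ u : W12 X, toHistory u = p.snd ∧ atZero u = p.fst}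
  add_mem' := by
    rintro p q ⟨hp, u, hu, hu'⟩ ⟨hq, v, hv, hv'⟩
    refine ⟨B.domain.add_mem hp hq, u + v, ?_, ?_⟩
    · rw [map_add, hu, hv]; rfl
    · rw [map_add, hu', hv']; rfl
  zero_mem' := ⟨B.domain.zero_mem, 0, map_zero _, map_zero _⟩
  smul_mem' := by
    rintro a p ⟨hp, u, hu, hu'⟩
    refine ⟨B.domain.smul_mem a hp, a • u, ?_, ?_⟩
    · rw [map_smul, hu]; rfl
    · rw [map_smul, hu']; rfl

/-- The first component of an element of the domain, as an element of `D(B)`. -/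
def delayDomainFst (B : X →ₗ.[ℂ] X) : delayDomain B →ₗ[ℂ] B.domain where
  toFun p := ⟨(p : StateSpace X).fst, p.2.1⟩
  map_add' _ _ := rfl
  map_smul' _ _ := rfl

/-- The second component of an element of the domain, as an element of the range of
`W^{1,2} → L²`. -/
def delayDomainSndAux (B : X →ₗ.[ℂ] X) :
    delayDomain B →ₗ[ℂ] LinearMap.range (toHistory : W12 X →ₗ[ℂ] History X) where
  toFun p := ⟨(p : StateSpace X).snd, p.2.2.imp fun _ h => h.1⟩
  map_add' _ _ := rfl
  map_smul' _ _ := rfl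

/-- The second component of an element of the domain, as an element of `W^{1,2}`. -/
def delayDomainSnd (B : X →ₗ.[ℂ] X) : delayDomain B →ₗ[ℂ] W12 X :=
  (toHistoryEquiv (X := X)).symm.toLinearMap.comp (delayDomainSndAux B)

lemma toHistory_delayDomainSnd (B : X →ₗ.[ℂ] X) (p : delayDomain B) :
    toHistory (delayDomainSnd B p) = (p : StateSpace X).snd :=
  congrArg Subtype.val ((toHistoryEquiv (X := X)).apply_symm_apply (delayDomainSndAux B p))

/-- The delay operator matrix `𝒜 (x, f) = (B x + Φ f, f')`. -/
def delayOperator (B : X →ₗ.[ℂ] X) (Φ : W12 X →L[ℂ] X) :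
    StateSpace X →ₗ.[ℂ] StateSpace X where
  domain := delayDomain B
  toFun :=
    { toFun := fun p => WithLp.toLp 2
        (B (delayDomainFst B p) + Φ (delayDomainSnd B p), derivative (delayDomainSnd B p))
      map_add' := by
        intro p q
        apply WithLp.ofLp_injective
        refine Prod.ext ?_ ?_
        · simp only [map_add, LinearPMap.map_add, WithLp.ofLp_add, Prod.fst_add]
          abel
        · simp only [map_add, WithLp.ofLp_add, Prod.snd_add]
      map_smul' := by
        intro a p
        apply WithLp.ofLp_injective
        refine Prod.ext ?_ ?_
        · simp only [map_smul, LinearPMap.map_smul, WithLp.ofLp_smul, Prod.smul_fst,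
            smul_add, RingHom.id_apply]
        · simp only [map_smul, WithLp.ofLp_smul, Prod.smul_snd, RingHom.id_apply] }

variable (X) in
/-- The generator `A₀` of the nilpotent left shift semigroup on `L²([-1, 0], X)`:
`A₀ f = f'` with domain `{f ∈ W^{1,2} : f(0) = 0}`. -/
def shiftGenerator : History X →ₗ.[ℂ] History X where
  domain := (LinearMap.ker (atZero : W12 X →ₗ[ℂ] X)).map toHistory
  toFun := (derivative.comp (toHistoryEquiv (X := X)).symm.toLinearMap).comp
    (Submodule.inclusion LinearMap.map_le_range)

/-- The scalar function `σ ↦ e ^ (l σ)` as an element of `L²([-1, 0], ℂ)`. -/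
def expHistory (l : ℂ) : History ℂ :=
  MemLp.toLp (fun σ : ℝ => Complex.exp (l * σ)) (by
    refine MemLp.of_bound (μ := mu) (by fun_prop) (Real.exp |l.re|) ?_
    filter_upwards [ae_mem_mu] with σ hσ
    rw [Complex.norm_exp]
    apply Real.exp_le_exp.2
    have h1 : |σ| ≤ 1 := abs_le.2 ⟨hσ.1, hσ.2.trans (by norm_num)⟩
    simp only [Complex.mul_re, Complex.ofReal_re, Complex.ofReal_im, mul_zero, sub_zero]
    calc l.re * σ ≤ |l.re * σ| := le_abs_self _
      _ = |l.re| * |σ| := abs_mul _ _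
      _ ≤ |l.re| := mul_le_of_le_one_right (abs_nonneg _) h1)

/-- `x ↦ e ^ (l ·) x` as a bounded operator from `X` to `L²([-1, 0], X)`. -/
def expTensorHistory (l : ℂ) : X →L[ℂ] History X :=
  LinearMap.mkContinuous
    { toFun := fun x => (ContinuousLinearMap.toSpanSingleton ℂ x).compLp (expHistory l)
      map_add' := fun x y => by
        rw [ContinuousLinearMap.toSpanSingleton_add, ContinuousLinearMap.add_compLp]
      map_smul' := fun a x => by
        rw [ContinuousLinearMap.toSpanSingleton_smul, ContinuousLinearMap.smul_compLp]
        rfl }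
    ‖expHistory l‖ (fun x => by
      refine (ContinuousLinearMap.norm_compLp_le _ _).trans ?_
      rw [ContinuousLinearMap.norm_toSpanSingleton, mul_comm])

lemma coeFn_expTensorHistory (l : ℂ) (x : X) :
    ∀ᵐ σ ∂mu, expTensorHistory l x σ = Complex.exp (l * σ) • x := by
  have h1 := ContinuousLinearMap.coeFn_compLp (ContinuousLinearMap.toSpanSingleton ℂ x)
    (expHistory l)
  have h2 : expHistory l =ᵐ[mu] fun σ : ℝ => Complex.exp (l * σ) := MemLp.coeFn_toLp _
  filter_upwards [h1, h2] with σ h3 h4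
  change (ContinuousLinearMap.toSpanSingleton ℂ x).compLp (expHistory l) σ = _
  rw [h3, h4]
  rfl

lemma isPrimitive_expTensorHistory (l : ℂ) (x : X) :
    IsPrimitive x (expTensorHistory l x) (l • expTensorHistory l x) := by
  have hg := ae_imp_of_ae_restrict (Lp.coeFn_smul l (expTensorHistory l x))
  have he := ae_imp_of_ae_restrict (coeFn_expTensorHistory l x)
  filter_upwards [coeFn_expTensorHistory l x, ae_mem_mu] with σ h1 hσ
  have e : ∫ s in (0 : ℝ)..σ, (l • expTensorHistory l x : History X) s =
      ∫ s in (0 : ℝ)..σ, (Complex.exp (l * s) * l) • x := by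
    refine intervalIntegral.integral_congr_ae ?_
    filter_upwards [hg, he] with s hs hs2 hs'
    rw [uIoc_of_ge hσ.2] at hs'
    have hm : s ∈ Icc (-1 : ℝ) 0 := ⟨hσ.1.trans hs'.1.le, hs'.2⟩
    rw [hs hm, Pi.smul_apply, hs2 hm, smul_smul, mul_comm]
  have d : ∀ s : ℝ, HasDerivAt (fun s : ℝ => Complex.exp (l * s) • x)
      ((Complex.exp (l * s) * l) • x) s := by
    intro s
    have h0 : HasDerivAt (fun s : ℝ => l * (s : ℂ)) l s := by
      simpa using (Complex.ofRealCLM.hasDerivAt (x := s)).const_mul l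
    exact h0.cexp.smul_const x
  rw [e, intervalIntegral.integral_eq_sub_of_hasDerivAt (fun s _ => d s)
    (by apply Continuous.intervalIntegrable; fun_prop), h1]
  simp

/-- `x ↦ (e ^ (l ·) x, l e ^ (l ·) x)` as a bounded operator from `X` to `L² × L²`. -/
def expTensorPair (l : ℂ) : X →L[ℂ] WithLp 2 (History X × History X) :=
  (WithLp.prodContinuousLinearEquiv 2 ℂ (History X) (History X)).symm.toContinuousLinearMap.comp
    ((expTensorHistory l).prod (l • expTensorHistory l))

lemma expTensorPair_mem (l : ℂ) (x : X) : expTensorPair l x ∈ W12 X :=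
  ⟨x, isPrimitive_expTensorHistory l x⟩

/-- `ε_l ⊗ Id`: the bounded operator `x ↦ e ^ (l ·) x` from `X` to `W^{1,2}([-1, 0], X)`. -/
def expTensor (l : ℂ) : X →L[ℂ] W12 X :=
  (expTensorPair l).codRestrict (W12 X) (expTensorPair_mem l)

/-- `Φ_l ∈ ℒ(X)`, `Φ_l x = Φ (e ^ (l ·) x)`. -/
def PhiAt (Φ : W12 X →L[ℂ] X) (l : ℂ) : X →L[ℂ] X := Φ.comp (expTensor l)

/-- Admissibility of the delay operator `Φ`:
(a) `𝒜` is a generator for every generator `B` on `X`;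
(b) `l ↦ Φ R(l, A₀) ∈ ℒ(L²([-1, 0], X), X)` is bounded and analytic on every half-plane
`{Re l > w}`, `w ∈ ℝ`. -/
def Admissible (Φ : W12 X →L[ℂ] X) : Prop :=
  (∀ B : X →ₗ.[ℂ] X, IsGenerator B → IsGenerator (delayOperator B Φ)) ∧
  ∃ K : ℂ → History X →L[ℂ] X,
    (∀ (l : ℂ) (h : History X), ∃ u : W12 X,
      toHistory u = resolvent (shiftGenerator X) l h ∧ K l h = Φ u) ∧
    ∀ w : ℝ, AnalyticOnNhd ℂ K {l : ℂ | w < l.re} ∧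
      ∃ C : ℝ, ∀ l : ℂ, w < l.re → ‖K l‖ ≤ C

end Delay

end DelayEquation

end

/-! That `𝒜` is a generator is admissibility (a). For the growth bound, the resolvent of `𝒜` is
written down and bounded uniformly on Re l ≥ α, and the Gearhart–Prüss theorem is applied. The
Hilbert space structure enters only there, through Plancherel.

Solving (l - 𝒜)(x, f) = (y, h) forces f = e^{l·}x + R(l, A₀)h. Then z = (l - B)x satisfies z - Φ_l
R(l, B) z = y + Φ R(l, A₀)h. If ‖Φ_l R(l, B)‖ ≤ q < 1, a Neumann series solves this with a bound
depending only on q and on bounds for R(l, B) and Φ R(l, A₀) (`exists_isResolventAt_delayOperator`).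

The hypothesis gives q only on the line Re l = α. By `phiAt_eq`, Φ_l is an affine expression in l Φ
R(l, A₀), so by admissibility (b) it is analytic and grows at most linearly, while R(l, B) is
analytic and bounded on Re l ≥ α. Phragmén–Lindelöf (`norm_le_of_linear_growth`) then carries q to
the half-plane.

Gearhart–Prüss (`growthBound_lt_of_resolvent_bounded`) lowers a growth exponent in steps of fixed
size. Plancherel turns the resolvent bound into a uniform square-integrability bound for the
rescaled orbits, and a quantitative Datko–Pazy theorem (`exists_decay_rate`) turns this into a gain
δ/2 that stays the same until the exponent is below α. -/

open MeasureTheory Set Filter Topology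

namespace DelayEquation

/-! ### Plancherel's theorem for Hilbert space valued functions -/

section Plancherel

open FourierTransform SchwartzMap

variable {F : Type*} [NormedAddCommGroup F] [InnerProductSpace ℂ F] [CompleteSpace F]

/-- On `L¹ ∩ L²` the `L²` Fourier transform is given by the Fourier integral. -/
theorem coeFn_fourier_toLp {f : ℝ → F} (h1 : Integrable f) (h2 : MemLp f 2) :
    (𝓕 (h2.toLp f) : Lp F 2 (volume : Measure ℝ)) =ᵐ[volume] 𝓕 f := by
  have hcont : Continuous (𝓕 f) :=
    VectorFourier.fourierIntegral_continuous Real.continuous_fourierChar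
      (by exact continuous_inner) h1
  -- Both sides are tested against smooth compactly supported g. The L² transform agrees with the
  -- distributional one, so in each case the transform moves onto the test function.
  refine ae_eq_of_integral_contDiff_smul_eq ((Lp.memLp _).locallyIntegrable (by norm_num))
    hcont.locallyIntegrable fun g g_smooth g_cpt => ?_
  have hg₁ : HasCompactSupport (Complex.ofRealCLM ∘ g) := g_cpt.comp_left rfl
  have hg₂ : ContDiff ℝ (↑(⊤ : ℕ∞)) (Complex.ofRealCLM ∘ g) := by fun_prop
  set φ : 𝓢(ℝ, ℂ) := hg₁.toSchwartzMap hg₂ with hφ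
  have e1 := congrArg (fun u => u φ) (Lp.fourier_toTemperedDistribution_eq (h2.toLp f))
  simp only [TemperedDistribution.fourier_apply, Lp.toTemperedDistribution_apply] at e1
  have e2 : ∫ x, (𝓕 φ) x • (h2.toLp f) x = ∫ x, (𝓕 φ) x • f x := by
    refine integral_congr_ae ?_
    filter_upwards [h2.coeFn_toLp] with x hx
    rw [hx]
  have e3 : ∫ x, (𝓕 φ) x • f x = ∫ x, φ x • (𝓕 f) x := by
    have := VectorFourier.integral_fourierIntegral_smul_eq_flip (L := innerₗ ℝ)
      Real.continuous_fourierChar (by exact continuous_inner) (φ.integrable (μ := volume)) h1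
    simpa using! this
  have e4 : ∀ u : ℝ → F, ∫ x, φ x • u x = ∫ x, g x • u x := fun u => by
    refine integral_congr_ae (ae_of_all _ fun x => ?_)
    simp [hφ]
  rw [← e4, ← e4, ← e3, ← e2, e1]

/-- Plancherel's theorem on `L¹ ∩ L²`. -/
theorem eLpNorm_fourier_eq {f : ℝ → F} (h1 : Integrable f) (h2 : MemLp f 2) :
    eLpNorm (𝓕 f) 2 volume = eLpNorm f 2 volume := by
  have h := Lp.norm_fourier_eq (h2.toLp f)
  rw [Lp.norm_def, Lp.norm_def, ENNReal.toReal_eq_toReal_iff' (Lp.eLpNorm_ne_top _)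
    (Lp.eLpNorm_ne_top _), eLpNorm_congr_ae (coeFn_fourier_toLp h1 h2),
    eLpNorm_congr_ae h2.coeFn_toLp] at h
  exact h

end Plancherel

/-! ### Semigroups, rescaling and the Laplace transform -/

section Semigroups

variable {E : Type*} [NormedAddCommGroup E] [NormedSpace ℂ E]

/-- The rescaled semigroup `t ↦ e ^ (l t) T t`. -/
noncomputable def rescale (l : ℂ) (T : ℝ → E →L[ℂ] E) (t : ℝ) : E →L[ℂ] E := Complex.exp (l * t) • T t

lemma rescale_apply (l : ℂ) (T : ℝ → E →L[ℂ] E) (t : ℝ) (x : E) :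
    rescale l T t x = Complex.exp (l * t) • T t x := rfl

lemma norm_rescale (l : ℂ) (T : ℝ → E →L[ℂ] E) (t : ℝ) :
    ‖rescale l T t‖ = Real.exp (l.re * t) * ‖T t‖ := by
  rw [rescale, norm_smul, Complex.norm_exp]
  simp

lemma rescale_rescale (l m : ℂ) (T : ℝ → E →L[ℂ] E) :
    rescale l (rescale m T) = rescale (l + m) T := by
  funext t
  rw [rescale, rescale, rescale, smul_smul, ← Complex.exp_add, add_mul]

lemma rescale_zero (T : ℝ → E →L[ℂ] E) : rescale 0 T = T := by
  funext t
  simp [rescale]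

lemma IsC0Semigroup.rescale {T : ℝ → E →L[ℂ] E} (hT : IsC0Semigroup T) (l : ℂ) :
    IsC0Semigroup (rescale l T) where
  map_zero := by simp [DelayEquation.rescale, hT.map_zero]
  map_add s t hs ht := by
    ext x
    simp only [DelayEquation.rescale, hT.map_add s t hs ht, _root_.smul_apply,
      ContinuousLinearMap.comp_apply, map_smul, smul_smul, ← Complex.exp_add]
    congr 2
    push_cast
    ring
  continuousOn x := by
    have h : Continuous fun t : ℝ => Complex.exp (l * t) := by fun_prop
    exact h.continuousOn.smul (hT.continuousOn x)

lemma norm_rescale_le {T : ℝ → E →L[ℂ] E} {M w : ℝ}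
    (hM : ∀ t : ℝ, 0 ≤ t → ‖T t‖ ≤ M * Real.exp (w * t)) (l : ℂ) {t : ℝ} (ht : 0 ≤ t) :
    ‖rescale l T t‖ ≤ M * Real.exp ((l.re + w) * t) := by
  rw [norm_rescale, add_mul, Real.exp_add]
  calc _ ≤ Real.exp (l.re * t) * (M * Real.exp (w * t)) :=
        mul_le_mul_of_nonneg_left (hM t ht) (Real.exp_pos _).le
    _ = _ := by ring

/-- An exponential bound for a semigroup in terms of its size on one period. -/
lemma IsC0Semigroup.norm_le_of_norm_le {T : ℝ → E →L[ℂ] E} (hT : IsC0Semigroup T)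
    {L q t₀ : ℝ} (ht₀ : 0 < t₀) (hq : 0 < q) (hL : ∀ t ∈ Icc 0 t₀, ‖T t‖ ≤ L)
    (hTq : ‖T t₀‖ ≤ q) {t : ℝ} (ht : 0 ≤ t) :
    ‖T t‖ ≤ L * Real.exp |Real.log q| * Real.exp (Real.log q / t₀ * t) := by
  have hL0 : 0 ≤ L := (norm_nonneg _).trans (hL 0 ⟨le_rfl, ht₀.le⟩)
  have key : ∀ n : ℕ, ∀ t ∈ Icc 0 ((n + 1) * t₀),
      ‖T t‖ ≤ L * Real.exp |Real.log q| * Real.exp (Real.log q / t₀ * t) := by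
    intro n
    induction n with
    | zero =>
      intro t ht
      have ht' : t ∈ Icc 0 t₀ := by simpa using ht
      refine (hL t ht').trans ?_
      rw [mul_assoc, ← Real.exp_add]
      refine le_mul_of_one_le_right hL0 (Real.one_le_exp ?_)
      -- The factor exp |log q| absorbs the incomplete period, whether q is below or above 1.
      have h1 : |Real.log q / t₀ * t| ≤ |Real.log q| := by
        rw [div_mul_eq_mul_div, mul_div_assoc, abs_mul]
        refine mul_le_of_le_one_right (abs_nonneg _) ?_
        rw [abs_of_nonneg (div_nonneg ht'.1 ht₀.le)]
        exact (div_le_one ht₀).2 ht'.2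
      linarith [neg_abs_le (Real.log q / t₀ * t)]
    | succ n ih =>
      intro t ht
      by_cases h : t ≤ (n + 1) * t₀
      · exact ih t ⟨ht.1, h⟩
      · have h0 : 0 ≤ t - t₀ := by nlinarith [(Nat.cast_nonneg n : (0 : ℝ) ≤ n)]
        have h1 := ih (t - t₀) ⟨h0, by have := ht.2; push_cast at this; linarith⟩
        have h2 : T t = (T (t - t₀)).comp (T t₀) := by
          rw [← hT.map_add _ _ h0 ht₀.le, sub_add_cancel]
        calc ‖T t‖ ≤ ‖T (t - t₀)‖ * ‖T t₀‖ := h2 ▸ ContinuousLinearMap.opNorm_comp_le _ _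
          _ ≤ L * Real.exp |Real.log q| * Real.exp (Real.log q / t₀ * (t - t₀)) * q := by
            gcongr
          _ = L * Real.exp |Real.log q| * Real.exp (Real.log q / t₀ * t) := by
            rw [mul_assoc (L * _)]
            nth_rw 3 [← Real.exp_log hq]
            rw [← Real.exp_add]
            congr 2
            field_simp
            ring
  obtain ⟨n, hn⟩ := exists_nat_ge (t / t₀)
  refine key n t ⟨ht, ?_⟩
  rw [div_le_iff₀ ht₀] at hn
  nlinarith

/-- Orbits are bounded on [0, 1] by strong continuity, hence the operators are by uniform
boundedness; the semigroup law does the rest. The maximum with 1 keeps q positive. -/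
lemma IsC0Semigroup.exists_norm_le [CompleteSpace E] {T : ℝ → E →L[ℂ] E}
    (hT : IsC0Semigroup T) :
    ∃ M w : ℝ, ∀ t : ℝ, 0 ≤ t → ‖T t‖ ≤ M * Real.exp (w * t) := by
  obtain ⟨L, hL⟩ := banach_steinhaus (g := fun t : Icc (0 : ℝ) 1 => T t) (fun x => by
    obtain ⟨C, hC⟩ := isCompact_Icc.exists_bound_of_continuousOn
      ((hT.continuousOn x).mono (Icc_subset_Ici_self : Icc (0 : ℝ) 1 ⊆ Ici 0))
    exact ⟨C, fun t => hC t t.2⟩)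
  refine ⟨_, _, fun t ht => hT.norm_le_of_norm_le (L := L) (q := max L 1) one_pos
    (lt_max_of_lt_right one_pos) (fun s hs => hL ⟨s, hs⟩)
    ((hL ⟨1, by simp⟩).trans (le_max_left _ _)) ht⟩

/-- As a one-sided derivative, the generator becomes accessible to the product and chain rules. -/
lemma generates_iff_hasDerivWithinAt {A : E →ₗ.[ℂ] E} {T : ℝ → E →L[ℂ] E}
    (hT : IsC0Semigroup T) : Generates A T ↔ ∀ x y : E, (x, y) ∈ A.graph ↔
      HasDerivWithinAt (fun t => T t x) y (Ioi 0) 0 := by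
  refine forall₂_congr fun x y => ?_
  rw [hasDerivWithinAt_iff_tendsto_slope' (by simp)]
  have : slope (fun t => T t x) 0 = fun t : ℝ => ((t⁻¹ : ℝ) : ℂ) • (T t x - x) := by
    funext t
    rw [slope_def_module, hT.map_zero, sub_zero, ContinuousLinearMap.id_apply, Complex.coe_smul]
  rw [this]

lemma hasDerivWithinAt_rescale {T : ℝ → E →L[ℂ] E} (hT : IsC0Semigroup T) {l : ℂ} {x y : E}
    (h : HasDerivWithinAt (fun t => T t x) y (Ioi 0) 0) :
    HasDerivWithinAt (fun t => rescale l T t x) (l • x + y) (Ioi 0) 0 := by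
  have h0 : HasDerivAt (fun s : ℝ => Complex.exp (l * (s : ℂ))) l 0 := by
    have h1 : HasDerivAt (fun s : ℝ => l * (s : ℂ)) l 0 := by
      simpa using (Complex.ofRealCLM.hasDerivAt (x := 0)).const_mul l
    simpa using h1.cexp
  simpa [rescale_apply, hT.map_zero, add_comm] using! h0.hasDerivWithinAt.smul h

lemma hasDerivWithinAt_rescale_iff {T : ℝ → E →L[ℂ] E} (hT : IsC0Semigroup T) (l : ℂ) {x y : E} :
    HasDerivWithinAt (fun t => rescale l T t x) (l • x + y) (Ioi 0) 0 ↔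
      HasDerivWithinAt (fun t => T t x) y (Ioi 0) 0 := by
  refine ⟨fun h => ?_, hasDerivWithinAt_rescale hT⟩
  have := hasDerivWithinAt_rescale (hT.rescale l) (l := -l) h
  simpa [rescale_rescale, rescale_zero] using this

lemma IsResolventAt.unique {A : E →ₗ.[ℂ] E} {l : ℂ} {R R' : E →L[ℂ] E}
    (h : IsResolventAt A l R) (h' : IsResolventAt A l R') : R = R' := by
  ext y
  obtain ⟨hy, e⟩ := h'.1 y
  have := h.2 ⟨R' y, hy⟩
  rwa [e] at this

/-- `resolvent` is a choice; uniqueness of the inverse lets any explicit one replace it. -/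
lemma resolvent_eq {A : E →ₗ.[ℂ] E} {l : ℂ} {R : E →L[ℂ] E} (h : IsResolventAt A l R) :
    resolvent A l = R := by
  have hl : l ∈ resolventSet A := ⟨R, h⟩
  rw [resolvent, dif_pos hl]
  exact (Classical.choose_spec hl).unique h

lemma IsC0Semigroup.integrableOn [CompleteSpace E] {T : ℝ → E →L[ℂ] E} (hT : IsC0Semigroup T)
    {M w : ℝ} (hw : w < 0) (hM : ∀ t : ℝ, 0 ≤ t → ‖T t‖ ≤ M * Real.exp (w * t)) (x : E) :
    IntegrableOn (fun t => T t x) (Ioi 0) := by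
  refine Integrable.mono' (((integrableOn_exp_mul_Ioi hw 0).const_mul M).mul_const ‖x‖)
    (((hT.continuousOn x).mono Ioi_subset_Ici_self).aestronglyMeasurable measurableSet_Ioi) ?_
  filter_upwards [ae_restrict_mem measurableSet_Ioi] with t ht
  exact (ContinuousLinearMap.le_opNorm _ _).trans
    (mul_le_mul_of_nonneg_right (hM t (le_of_lt ht)) (norm_nonneg _))

/-- The integral of an exponentially stable semigroup. -/
noncomputable def integralCLM [CompleteSpace E] {T : ℝ → E →L[ℂ] E} (hT : IsC0Semigroup T)
    {M w : ℝ} (hw : w < 0) (hM : ∀ t : ℝ, 0 ≤ t → ‖T t‖ ≤ M * Real.exp (w * t)) : E →L[ℂ] E :=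
  LinearMap.mkContinuous
    { toFun := fun x => ∫ t in Ioi (0 : ℝ), T t x
      map_add' := fun x y => by
        simp only [map_add]
        exact integral_add (hT.integrableOn hw hM x) (hT.integrableOn hw hM y)
      map_smul' := fun a x => by
        simp only [map_smul]
        exact integral_smul a _ }
    (M / -w) (fun x => by
      have h : ‖∫ t in Ioi (0 : ℝ), T t x‖ ≤ ∫ t in Ioi (0 : ℝ), M * Real.exp (w * t) * ‖x‖ := by
        refine norm_integral_le_of_norm_le
          (((integrableOn_exp_mul_Ioi hw 0).const_mul M).mul_const ‖x‖) ?_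
        filter_upwards [ae_restrict_mem measurableSet_Ioi] with t ht
        exact (ContinuousLinearMap.le_opNorm _ _).trans
          (mul_le_mul_of_nonneg_right (hM t (le_of_lt ht)) (norm_nonneg _))
      refine h.trans_eq ?_
      rw [integral_mul_const, integral_const_mul, integral_exp_mul_Ioi hw]
      simp only [mul_zero, Real.exp_zero]
      rw [neg_div, div_neg, mul_neg, mul_one_div])

lemma integralCLM_apply [CompleteSpace E] {T : ℝ → E →L[ℂ] E} (hT : IsC0Semigroup T)
    {M w : ℝ} (hw : w < 0) (hM : ∀ t : ℝ, 0 ≤ t → ‖T t‖ ≤ M * Real.exp (w * t)) (x : E) :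
    integralCLM hT hw hM x = ∫ t in Ioi (0 : ℝ), T t x := rfl

lemma norm_integralCLM_le [CompleteSpace E] {T : ℝ → E →L[ℂ] E} (hT : IsC0Semigroup T)
    {M w : ℝ} (hw : w < 0) (hM : ∀ t : ℝ, 0 ≤ t → ‖T t‖ ≤ M * Real.exp (w * t)) :
    ‖integralCLM hT hw hM‖ ≤ M / -w := by
  refine LinearMap.mkContinuous_norm_le _ (div_nonneg ?_ (by linarith)) _
  simpa using (norm_nonneg _).trans (hM 0 le_rfl)

/-- Applying T h shifts the integral to (h, ∞). Commutation will make the integral a left inverse of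
the generator up to sign; the second identity, differentiated at h = 0, a right inverse. -/
lemma semigroup_integralCLM [CompleteSpace E] {T : ℝ → E →L[ℂ] E} (hT : IsC0Semigroup T)
    {M w : ℝ} (hw : w < 0) (hM : ∀ t : ℝ, 0 ≤ t → ‖T t‖ ≤ M * Real.exp (w * t)) (x : E)
    {h : ℝ} (hh : 0 ≤ h) :
    T h (integralCLM hT hw hM x) = integralCLM hT hw hM (T h x) ∧
      T h (integralCLM hT hw hM x) = integralCLM hT hw hM x - ∫ t in (0 : ℝ)..h, T t x := by
  have hi := hT.integrableOn hw hM x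
  have e1 : T h (integralCLM hT hw hM x) = ∫ t in Ioi (0 : ℝ), T (t + h) x := by
    rw [integralCLM_apply, ← ContinuousLinearMap.integral_comp_comm _ hi]
    refine setIntegral_congr_fun measurableSet_Ioi fun t ht => ?_
    change T h (T t x) = T (t + h) x
    rw [add_comm t h, hT.map_add _ _ hh (le_of_lt ht), ContinuousLinearMap.comp_apply]
  constructor
  · rw [e1, integralCLM_apply]
    refine setIntegral_congr_fun measurableSet_Ioi fun t ht => ?_
    rw [hT.map_add _ _ (le_of_lt ht) hh, ContinuousLinearMap.comp_apply]
  · rw [e1, integralCLM_apply, ← intervalIntegral.integral_Ioi_sub_Ioi hi hh, sub_sub_cancel]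
    have := (measurePreserving_add_right volume h).setIntegral_preimage_emb
      (measurableEmbedding_addRight h) (fun t => T t x) (Ioi h)
    simpa using this

lemma hasDerivWithinAt_integralCLM [CompleteSpace E] {T : ℝ → E →L[ℂ] E} (hT : IsC0Semigroup T)
    {M w : ℝ} (hw : w < 0) (hM : ∀ t : ℝ, 0 ≤ t → ‖T t‖ ≤ M * Real.exp (w * t)) (x : E) :
    HasDerivWithinAt (fun t => T t (integralCLM hT hw hM x)) (-x) (Ioi 0) 0 := by
  have d : HasDerivWithinAt (fun h : ℝ => ∫ t in (0 : ℝ)..h, T t x) x (Ioi 0) 0 := by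
    have h1 := intervalIntegral.integral_hasDerivWithinAt_right (a := 0) (b := 0)
      (f := fun t => T t x) (s := Ici 0) (t := Ioi 0) IntervalIntegrable.refl
      ⟨Ioi 0, self_mem_nhdsWithin,
        (((hT.continuousOn x).mono Ioi_subset_Ici_self).aestronglyMeasurable measurableSet_Ioi)⟩
      ((hT.continuousOn x 0 (by simp)).mono Ioi_subset_Ici_self)
    simpa [hT.map_zero] using h1.mono Ioi_subset_Ici_self
  have d2 := d.const_sub (integralCLM hT hw hM x)
  refine d2.congr (fun h hh => (semigroup_integralCLM hT hw hM x (le_of_lt hh)).2)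
    (semigroup_integralCLM hT hw hM x le_rfl).2

/-- The Laplace transform of a semigroup is the resolvent of its generator. -/
theorem isResolventAt_integralCLM [CompleteSpace E] {A : E →ₗ.[ℂ] E} {T : ℝ → E →L[ℂ] E}
    (hT : IsC0Semigroup T) (hA : Generates A T) {l : ℂ} {M w : ℝ} (hw : w < 0)
    (hM : ∀ t : ℝ, 0 ≤ t → ‖rescale (-l) T t‖ ≤ M * Real.exp (w * t)) :
    IsResolventAt A l (integralCLM (hT.rescale (-l)) hw hM) := by
  rw [generates_iff_hasDerivWithinAt hT] at hA
  set R := integralCLM (hT.rescale (-l)) hw hM with hR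
  constructor
  · intro y
    have h1 := hasDerivWithinAt_integralCLM (hT.rescale (-l)) hw hM y
    rw [← hR] at h1
    -- In this form the rescaling can be undone, which places R y in the domain with A (R y) = l R y
    -- - y.
    have h2 : -y = (-l) • R y + (l • R y - y) := by
      rw [neg_smul]; abel
    rw [h2, hasDerivWithinAt_rescale_iff hT, ← hA, LinearPMap.mem_graph_iff] at h1
    obtain ⟨z, hz, hz'⟩ := h1
    have hm : R y ∈ A.domain := (show (z : E) = R y from hz) ▸ z.2
    refine ⟨hm, ?_⟩
    have : z = ⟨R y, hm⟩ := Subtype.ext hz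
    rw [← this, hz', sub_sub_cancel]
  · intro x
    have h1 : HasDerivWithinAt (fun t => T t x) (A x) (Ioi 0) 0 :=
      (hA _ _).1 (LinearPMap.mem_graph A x)
    have h2 := hasDerivWithinAt_rescale hT (l := -l) h1
    have h3 := R.restrictScalars ℝ |>.hasFDerivAt.comp_hasDerivWithinAt 0 h2
    have h4 : HasDerivWithinAt (fun t => R (rescale (-l) T t x)) (-(x : E)) (Ioi 0) 0 :=
      (hasDerivWithinAt_integralCLM (hT.rescale (-l)) hw hM x).congr
        (fun h hh => ((semigroup_integralCLM (hT.rescale (-l)) hw hM x (le_of_lt hh)).1).symm)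
        ((semigroup_integralCLM (hT.rescale (-l)) hw hM x le_rfl).1).symm
    -- The right derivative of h ↦ R (e^{-lh} T h x) at 0 is computed twice: by the chain rule and
    -- by commuting R past the semigroup.
    have h5 := (uniqueDiffWithinAt_Ioi (0 : ℝ)).eq_deriv _ h3 h4
    have h6 : R (-l • (x : E) + A x) = -(x : E) := h5
    rw [← neg_inj, ← map_neg, ← h6]
    congr 1
    rw [neg_smul]; abel

/-- The rescaled semigroup e^{-lt} T t has the negative exponent w - Re l, so its integral exists
and gives the bound. -/
theorem exists_isResolventAt [CompleteSpace E] {A : E →ₗ.[ℂ] E} {T : ℝ → E →L[ℂ] E}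
    (hT : IsC0Semigroup T) (hA : Generates A T) {M w : ℝ}
    (hM : ∀ t : ℝ, 0 ≤ t → ‖T t‖ ≤ M * Real.exp (w * t)) {l : ℂ} (hl : w < l.re) :
    ∃ R : E →L[ℂ] E, IsResolventAt A l R ∧ ‖R‖ ≤ M / (l.re - w) ∧
      ∀ x, R x = ∫ t in Ioi (0 : ℝ), rescale (-l) T t x := by
  have hw : (-l).re + w < 0 := by rw [Complex.neg_re]; linarith
  have hM' : ∀ t : ℝ, 0 ≤ t → ‖rescale (-l) T t‖ ≤ M * Real.exp (((-l).re + w) * t) :=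
    fun t ht => norm_rescale_le hM (-l) ht
  refine ⟨_, isResolventAt_integralCLM hT hA hw hM', ?_, fun x => rfl⟩
  refine (norm_integralCLM_le (hT.rescale (-l)) hw hM').trans_eq ?_
  rw [Complex.neg_re]
  congr 1
  ring

/-- The first resolvent identity. -/
lemma IsResolventAt.sub_eq {A : E →ₗ.[ℂ] E} {l m : ℂ} {R S : E →L[ℂ] E}
    (hR : IsResolventAt A l R) (hS : IsResolventAt A m S) (x : E) :
    R x = S x + (m - l) • R (S x) := by
  obtain ⟨hx, e⟩ := hS.1 x
  have h := hR.2 ⟨S x, hx⟩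
  have e2 : x = (l • S x - A ⟨S x, hx⟩) + (m - l) • S x := by
    nth_rw 1 [← e]
    rw [sub_smul]; abel
  nth_rw 1 [e2]
  rw [map_add, map_smul]
  exact congrArg (· + _) h

end Semigroups

/-! ### The Datko–Pazy theorem with uniform constants -/

section Stability

variable {E : Type*} [NormedAddCommGroup E] [NormedSpace ℂ E]

-- The pointwise bound is integrated over a window of length r, which lies in (0, ∞) because r ≤ t.
omit [NormedSpace ℂ E] in
lemma mul_sq_le_of_lintegral_le {f : ℝ → E} {y : E} {K D r t : ℝ} (hD : 0 ≤ D) (hrt : r ≤ t) (h : ∀ s ∈ Ioc (t - r) t, ‖y‖ ≤ K * ‖f s‖)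
    (hf : ∫⁻ s in Ioi (0 : ℝ), ‖f s‖ₑ ^ 2 ≤ ENNReal.ofReal D) :
    r * ‖y‖ ^ 2 ≤ K ^ 2 * D := by
  rw [← ENNReal.ofReal_le_ofReal_iff (by positivity)]
  calc ENNReal.ofReal (r * ‖y‖ ^ 2) = ∫⁻ s in Ioc (t - r) t, ENNReal.ofReal (‖y‖ ^ 2) := by
        rw [setLIntegral_const, Real.volume_Ioc, sub_sub_cancel, mul_comm,
          ENNReal.ofReal_mul (by positivity)]
    _ ≤ ∫⁻ s in Ioc (t - r) t, ENNReal.ofReal (K ^ 2) * ‖f s‖ₑ ^ 2 := by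
        refine setLIntegral_mono' measurableSet_Ioc fun s hs => ?_
        rw [← ofReal_norm, ← ENNReal.ofReal_pow (norm_nonneg _),
          ← ENNReal.ofReal_mul (by positivity), ← mul_pow]
        exact ENNReal.ofReal_le_ofReal (pow_le_pow_left₀ (norm_nonneg _) (h s hs) 2)
    _ ≤ ∫⁻ s in Ioi (0 : ℝ), ENNReal.ofReal (K ^ 2) * ‖f s‖ₑ ^ 2 :=
        lintegral_mono_set fun s hs => lt_of_le_of_lt (sub_nonneg.2 hrt) hs.1
    _ = ENNReal.ofReal (K ^ 2) * ∫⁻ s in Ioi (0 : ℝ), ‖f s‖ₑ ^ 2 :=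
        lintegral_const_mul' _ _ ENNReal.ofReal_ne_top
    _ ≤ ENNReal.ofReal (K ^ 2 * D) := by
        rw [ENNReal.ofReal_mul (by positivity)]
        gcongr

/-- The theorem of Datko and Pazy with a decay rate that depends only on the given constants. -/
theorem exists_decay_rate {M v C : ℝ} (hM : 1 ≤ M) (hv : 0 ≤ v) (hC : 0 ≤ C) :
    ∃ δ : ℝ, 0 < δ ∧ δ ≤ 1 ∧ ∀ S : ℝ → E →L[ℂ] E, IsC0Semigroup S →
      (∀ t : ℝ, 0 ≤ t → ‖S t‖ ≤ M * Real.exp (v * t)) →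
      (∀ x, ∫⁻ t in Ioi (0 : ℝ), ‖S t x‖ₑ ^ 2 ≤ ENNReal.ofReal (C * ‖x‖ ^ 2)) →
      ∃ M' : ℝ, ∀ t : ℝ, 0 ≤ t → ‖S t‖ ≤ M' * Real.exp (-δ * t) := by
  set K : ℝ := M * Real.exp v with hKdef
  have hK : 1 ≤ K := one_le_mul_of_one_le_of_one_le hM (Real.one_le_exp hv)
  set L : ℝ := K * (1 + C) with hLdef
  have hL : K ≤ L := le_mul_of_one_le_right (by linarith) (by linarith)
  -- Chosen so that L² C ≤ t₀ / 4: then t₀ ‖S t₀ x‖² ≤ L² C ‖x‖² forces ‖S t₀‖ ≤ 1/2.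
  set t₀ : ℝ := 4 * (L ^ 2 * C) + 1 with ht₀def
  have ht₀ : 1 ≤ t₀ := by
    have : 0 ≤ L ^ 2 * C := by positivity
    linarith
  have ht₀' : 0 < t₀ := by linarith
  refine ⟨Real.log 2 / t₀, div_pos (Real.log_pos one_lt_two) ht₀', ?_, ?_⟩
  · rw [div_le_one ht₀']
    linarith [Real.log_two_lt_d9]
  intro S hS hSM hint
  have hloc : ∀ s ∈ Icc (0 : ℝ) 1, ‖S s‖ ≤ K := fun s hs => by
    refine (hSM s hs.1).trans ?_
    rw [hKdef]
    gcongr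
    exact mul_le_of_le_one_right hv hs.2
  have hcomp : ∀ {t s : ℝ}, 0 ≤ s → s ≤ t → ∀ x, ‖S t x‖ ≤ ‖S (t - s)‖ * ‖S s x‖ := by
    intro t s hs hst x
    have : S t x = S (t - s) (S s x) := by
      rw [← ContinuousLinearMap.comp_apply, ← hS.map_add _ _ (sub_nonneg.2 hst) hs,
        sub_add_cancel]
    rw [this]
    exact ContinuousLinearMap.le_opNorm _ _
  -- A window of length 1 before t gives ‖S t x‖² ≤ K² C ‖x‖², and K² C ≤ L².
  have hunif : ∀ t : ℝ, 0 ≤ t → ‖S t‖ ≤ L := by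
    intro t ht
    by_cases h1 : t ≤ 1
    · exact (hloc t ⟨ht, h1⟩).trans hL
    · refine ContinuousLinearMap.opNorm_le_bound _ (by linarith) fun x => ?_
      have h := mul_sq_le_of_lintegral_le (f := fun t => S t x) (y := S t x) (K := K) (r := 1)
        (t := t) (D := C * ‖x‖ ^ 2) (by positivity) (by linarith)
        (fun s hs => (hcomp (by linarith [hs.1]) hs.2 x).trans
          (mul_le_mul_of_nonneg_right (hloc _ ⟨by linarith [hs.2], by linarith [hs.1]⟩)
            (norm_nonneg _))) (hint x)
      refine le_of_sq_le_sq ?_ (by positivity)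
      rw [hLdef]
      nlinarith [mul_nonneg (sq_nonneg K) (mul_nonneg (by positivity : 0 ≤ 1 + C + C ^ 2)
        (sq_nonneg ‖x‖))]
  have hhalf : ‖S t₀‖ ≤ 1 / 2 := by
    refine ContinuousLinearMap.opNorm_le_bound _ (by norm_num) fun x => ?_
    have h := mul_sq_le_of_lintegral_le (f := fun t => S t x) (y := S t₀ x) (K := L) (r := t₀)
        (t := t₀) (D := C * ‖x‖ ^ 2) (by positivity) le_rfl
        (fun s hs => (hcomp (by linarith [hs.1]) hs.2 x).trans
          (mul_le_mul_of_nonneg_right (hunif _ (by linarith [hs.2])) (norm_nonneg _))) (hint x)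
    refine le_of_sq_le_sq ?_ (by positivity)
    have h2 : L ^ 2 * (C * ‖x‖ ^ 2) ≤ t₀ * (1 / 2 * ‖x‖) ^ 2 := by
      rw [ht₀def]
      nlinarith [sq_nonneg ‖x‖]
    exact le_of_mul_le_mul_left (h.trans h2) ht₀'
  have h := fun t ht => hS.norm_le_of_norm_le (t := t) ht₀' (by norm_num : (0 : ℝ) < 1 / 2)
    (fun s hs => hunif s hs.1) hhalf ht
  have e : Real.log (1 / 2) / t₀ = -(Real.log 2 / t₀) := by
    rw [one_div, Real.log_inv, neg_div]
  rw [e] at h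
  exact ⟨_, h⟩

end Stability

/-! ### The Gearhart–Prüss theorem -/

section Gearhart

open FourierTransform

variable {H : Type*} [NormedAddCommGroup H]

section

variable [NormedSpace ℂ H]

lemma lintegral_semigroup_le {S : ℝ → H →L[ℂ] H} {M w : ℝ}
    (hw : w < 0) (hM : ∀ t : ℝ, 0 ≤ t → ‖S t‖ ≤ M * Real.exp (w * t)) (x : H) :
    ∫⁻ t in Ioi (0 : ℝ), ‖S t x‖ₑ ^ 2 ≤ ENNReal.ofReal (M ^ 2 / (2 * -w) * ‖x‖ ^ 2) := by
  have hw2 : 2 * w < 0 := by linarith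
  have hi := ((integrableOn_exp_mul_Ioi hw2 0).const_mul (M ^ 2)).mul_const (‖x‖ ^ 2)
  calc _ ≤ ∫⁻ t in Ioi (0 : ℝ),
          ENNReal.ofReal (M ^ 2 * Real.exp (2 * w * t) * ‖x‖ ^ 2) := by
        refine setLIntegral_mono' measurableSet_Ioi fun t ht => ?_
        rw [← ofReal_norm, ← ENNReal.ofReal_pow (norm_nonneg _)]
        refine ENNReal.ofReal_le_ofReal ?_
        have h1 : ‖S t x‖ ≤ M * Real.exp (w * t) * ‖x‖ :=
          (ContinuousLinearMap.le_opNorm _ _).trans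
            (mul_le_mul_of_nonneg_right (hM t (le_of_lt ht)) (norm_nonneg _))
        refine (pow_le_pow_left₀ (norm_nonneg _) h1 2).trans_eq ?_
        rw [mul_pow, mul_pow, ← Real.exp_nat_mul]
        congr 3
        push_cast
        ring
    _ = ENNReal.ofReal (∫ t in Ioi (0 : ℝ), M ^ 2 * Real.exp (2 * w * t) * ‖x‖ ^ 2) :=
        (ofReal_integral_eq_lintegral_ofReal hi (ae_of_all _ fun t => by positivity)).symm
    _ = _ := by
        rw [integral_mul_const, integral_const_mul, integral_exp_mul_Ioi hw2]
        congr 1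
        simp only [mul_zero, Real.exp_zero]
        field_simp

lemma integrable_indicator_semigroup [CompleteSpace H] {S : ℝ → H →L[ℂ] H}
    (hS : IsC0Semigroup S) {M w : ℝ}
    (hw : w < 0) (hM : ∀ t : ℝ, 0 ≤ t → ‖S t‖ ≤ M * Real.exp (w * t)) (x : H) :
    Integrable ((Ioi 0).indicator fun t => S t x) :=
  (hS.integrableOn hw hM x).integrable_indicator measurableSet_Ioi

omit [NormedSpace ℂ H] in
lemma lintegral_indicator_sq {s : Set ℝ} (hs : MeasurableSet s) (f : ℝ → H) :
    ∫⁻ t, ‖s.indicator f t‖ₑ ^ 2 = ∫⁻ t in s, ‖f t‖ₑ ^ 2 := by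
  rw [← lintegral_indicator hs]
  refine lintegral_congr fun t => ?_
  by_cases h : t ∈ s <;> simp [h]

lemma memLp_indicator_semigroup [CompleteSpace H] {S : ℝ → H →L[ℂ] H}
    (hS : IsC0Semigroup S) {M w : ℝ}
    (hw : w < 0) (hM : ∀ t : ℝ, 0 ≤ t → ‖S t‖ ≤ M * Real.exp (w * t)) (x : H) :
    MemLp ((Ioi 0).indicator fun t => S t x) 2 := by
  refine ⟨(integrable_indicator_semigroup hS hw hM x).aestronglyMeasurable, ?_⟩
  rw [eLpNorm_lt_top_iff_lintegral_rpow_enorm_lt_top two_ne_zero ENNReal.ofNat_ne_top]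
  simp only [ENNReal.toReal_ofNat, ENNReal.rpow_ofNat]
  rw [lintegral_indicator_sq measurableSet_Ioi]
  exact (lintegral_semigroup_le hw hM x).trans_lt ENNReal.ofReal_lt_top

end

variable [InnerProductSpace ℂ H] [CompleteSpace H]

lemma lintegral_fourier_sq {f : ℝ → H} (h1 : Integrable f) (h2 : MemLp f 2) :
    ∫⁻ ξ, ‖𝓕 f ξ‖ₑ ^ 2 = ∫⁻ t, ‖f t‖ₑ ^ 2 := by
  have h := congrArg (· ^ (2 : ℝ)) (eLpNorm_fourier_eq h1 h2)
  have e : ∀ g : ℝ → H, eLpNorm g 2 volume ^ (2 : ℝ) = ∫⁻ ξ, ‖g ξ‖ₑ ^ 2 := fun g => by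
    simpa using eLpNorm_nnreal_pow_eq_lintegral (f := g) (μ := volume) (p := 2) two_ne_zero
  simpa only [e] using h

/-- Plancherel's theorem for the Laplace transform of a semigroup on a vertical line. -/
lemma lintegral_semigroup_eq {A : H →ₗ.[ℂ] H} {T : ℝ → H →L[ℂ] H} (hT : IsC0Semigroup T)
    (hA : Generates A T) {M w a : ℝ}
    (hM : ∀ t : ℝ, 0 ≤ t → ‖T t‖ ≤ M * Real.exp (w * t)) (ha : w < a) (x : H) :
    ∫⁻ t in Ioi (0 : ℝ), ‖rescale (-a) T t x‖ₑ ^ 2 =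
      ∫⁻ ξ : ℝ, ‖resolvent A (a + 2 * Real.pi * ξ * Complex.I) x‖ₑ ^ 2 := by
  have hw : ((-a : ℝ) : ℂ).re + w < 0 := by simpa using ha
  have hM' : ∀ t : ℝ, 0 ≤ t → ‖rescale ((-a : ℝ) : ℂ) T t‖ ≤ M * Real.exp (_ * t) :=
    fun t ht => norm_rescale_le hM _ ht
  have hS := hT.rescale ((-a : ℝ) : ℂ)
  have h := lintegral_fourier_sq (integrable_indicator_semigroup hS hw hM' x)
    (memLp_indicator_semigroup hS hw hM' x)
  rw [lintegral_indicator_sq measurableSet_Ioi] at h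
  push_cast at h
  rw [← h]
  refine lintegral_congr fun ξ => ?_
  -- With the kernel e^{-2πiξt}, the transform at ξ of the orbit cut off at 0 is the Laplace
  -- transform at a + 2πiξ; in this variable Plancherel carries no constant.
  obtain ⟨R, hR, -, hRx⟩ := exists_isResolventAt hT hA hM
    (l := a + 2 * Real.pi * ξ * Complex.I) (by simpa using ha)
  rw [resolvent_eq hR, hRx, Real.fourier_real_eq_integral_exp_smul,
    ← integral_indicator measurableSet_Ioi]
  congr 2
  refine integral_congr_ae (ae_of_all _ fun t => ?_)
  by_cases ht : t ∈ Ioi (0 : ℝ)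
  · simp only [indicator_of_mem ht, rescale_apply, smul_smul, ← Complex.exp_add]
    congr 2
    push_cast
    ring
  · simp only [indicator_of_notMem ht, smul_zero]

/-- The Gearhart–Prüss theorem: a bound for the resolvent on a closed right half-plane gives
a bound for the growth of the semigroup. -/
theorem growthBound_lt_of_resolvent_bounded {A : H →ₗ.[ℂ] H} (hA : IsGenerator A) {α N : ℝ}
    (hN : ∀ l : ℂ, α ≤ l.re → ∃ R : H →L[ℂ] H, IsResolventAt A l R ∧ ‖R‖ ≤ N) :
    growthBound A < α := by
  obtain ⟨T, hT, hAT⟩ := hA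
  obtain ⟨M₁, w₁, hM₁⟩ := hT.exists_norm_le
  set M : ℝ := max M₁ 1
  set w₀ : ℝ := max w₁ α
  have hM : ∀ t : ℝ, 0 ≤ t → ‖T t‖ ≤ M * Real.exp (w₀ * t) := fun t ht =>
    (hM₁ t ht).trans (mul_le_mul (le_max_left _ _)
      (Real.exp_le_exp.2 (mul_le_mul_of_nonneg_right (le_max_left _ _) ht))
      (Real.exp_pos _).le (zero_le_one.trans (le_max_right _ _)))
  have hw₀ : α ≤ w₀ := le_max_right _ _
  have hN0 : 0 ≤ N := by
    obtain ⟨R, -, hR⟩ := hN α (by simp)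
    exact (norm_nonneg _).trans hR
  -- A reference line: e^{-wt} T t is bounded by M e^{-t}, whose square integral is M²/2. The
  -- resolvent identity transfers this estimate to any line a ∈ [α, w] at the cost of the factor 1 +
  -- (w - α) N.
  set w : ℝ := w₀ + 1
  set C : ℝ := (1 + (w - α) * N) ^ 2 * (M ^ 2 / 2) with hC
  -- The exponent w₀ - α serves all rescalings by a ≥ α at once, so δ does not depend on a.
  obtain ⟨δ, hδ0, hδ1, hδ⟩ := exists_decay_rate (E := H) (M := M) (v := w₀ - α) (C := C)
    (le_max_right _ _) (by linarith) (by positivity)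
  have hcomp : ∀ a a' : ℝ, α ≤ a → a ≤ w → a' < a →
      (∃ M' : ℝ, ∀ t : ℝ, 0 ≤ t → ‖T t‖ ≤ M' * Real.exp (a' * t)) → ∀ x : H,
      ∫⁻ t in Ioi (0 : ℝ), ‖rescale (-a) T t x‖ₑ ^ 2 ≤ ENNReal.ofReal (C * ‖x‖ ^ 2) := by
    rintro a a' ha haw haa ⟨M', hM'⟩ x
    rw [lintegral_semigroup_eq hT hAT hM' haa]
    calc _ ≤ ∫⁻ ξ : ℝ, ENNReal.ofReal ((1 + (w - α) * N) ^ 2) *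
            ‖resolvent A (w + 2 * Real.pi * ξ * Complex.I) x‖ₑ ^ 2 := by
          refine lintegral_mono fun ξ => ?_
          obtain ⟨R, hR, hRN⟩ := hN (a + 2 * Real.pi * ξ * Complex.I) (by simpa using ha)
          obtain ⟨R', hR', -⟩ := hN (w + 2 * Real.pi * ξ * Complex.I)
            (by simpa using ha.trans haw)
          rw [resolvent_eq hR, resolvent_eq hR', ← ofReal_norm, ← ofReal_norm,
            ← ENNReal.ofReal_pow (norm_nonneg _), ← ENNReal.ofReal_pow (norm_nonneg _),
            ← ENNReal.ofReal_mul (by positivity), ← mul_pow]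
          refine ENNReal.ofReal_le_ofReal (pow_le_pow_left₀ (norm_nonneg _) ?_ 2)
          have e : ((w : ℂ) + 2 * Real.pi * ξ * Complex.I) - (a + 2 * Real.pi * ξ * Complex.I)
              = ((w - a : ℝ) : ℂ) := by
            push_cast
            ring
          rw [hR.sub_eq hR' x, e]
          refine (norm_add_le _ _).trans ?_
          rw [norm_smul, Complex.norm_real, Real.norm_of_nonneg (by linarith), add_mul, one_mul,
            mul_assoc]
          have hwα : 0 ≤ w - α := by linarith
          gcongr
          exact R.le_of_opNorm_le hRN _
      _ = ENNReal.ofReal ((1 + (w - α) * N) ^ 2) *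
            ∫⁻ t in Ioi (0 : ℝ), ‖rescale (-w) T t x‖ₑ ^ 2 := by
          rw [lintegral_const_mul' _ _ ENNReal.ofReal_ne_top,
            lintegral_semigroup_eq hT hAT hM (lt_add_one w₀)]
      _ ≤ ENNReal.ofReal ((1 + (w - α) * N) ^ 2) * ENNReal.ofReal (M ^ 2 / 2 * ‖x‖ ^ 2) := by
          gcongr
          have h1 := lintegral_semigroup_le (S := rescale (-w) T) (w := -1) (M := M) (by norm_num)
            (fun t ht => (norm_rescale_le hM (-w) ht).trans_eq (by simp [w])) x
          simpa using h1
      _ = ENNReal.ofReal (C * ‖x‖ ^ 2) := by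
          rw [← ENNReal.ofReal_mul (by positivity), hC, mul_assoc]
  have hstep : ∀ a : ℝ, α ≤ a → a ≤ w₀ →
      (∃ M' : ℝ, ∀ t : ℝ, 0 ≤ t → ‖T t‖ ≤ M' * Real.exp (a * t)) →
      ∃ M' : ℝ, ∀ t : ℝ, 0 ≤ t → ‖T t‖ ≤ M' * Real.exp ((a - δ / 2) * t) := by
    -- Plancherel needs a line strictly right of the exponent a, so a + δ/2 is used; the decay δ
    -- then leaves a net gain of δ/2. The bound δ ≤ 1 keeps the line left of w.
    intro a ha haw haS
    obtain ⟨M', hM'⟩ := hδ (rescale (-((a + δ / 2 : ℝ) : ℂ)) T) (hT.rescale _)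
      (fun t ht => (norm_rescale_le hM _ ht).trans (by
        gcongr
        simp only [Complex.neg_re, Complex.ofReal_re]
        linarith))
      (hcomp (a + δ / 2) a (by linarith) (by simp only [w]; linarith) (by linarith) haS)
    refine ⟨M', fun t ht => ?_⟩
    have h1 := norm_rescale_le hM' ((a + δ / 2 : ℝ) : ℂ) ht
    rw [rescale_rescale, add_neg_cancel, rescale_zero, Complex.ofReal_re] at h1
    refine h1.trans_eq ?_
    congr 3
    ring
  -- The step is available only while the exponent is at least α, the region where the resolvent is
  -- bounded; hence the alternative.
  have hiter : ∀ n : ℕ,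
      (∃ a < α, ∃ M' : ℝ, ∀ t : ℝ, 0 ≤ t → ‖T t‖ ≤ M' * Real.exp (a * t)) ∨
      ∃ M' : ℝ, ∀ t : ℝ, 0 ≤ t → ‖T t‖ ≤ M' * Real.exp ((w₀ - n * (δ / 2)) * t) := by
    intro n
    induction n with
    | zero => exact Or.inr ⟨M, by simpa using hM⟩
    | succ n ih =>
      rcases ih with h | h
      · exact Or.inl h
      · by_cases hn : w₀ - n * (δ / 2) < α
        · exact Or.inl ⟨_, hn, h⟩
        · refine Or.inr ?_
          obtain ⟨M', hM'⟩ := hstep _ (not_lt.1 hn) (sub_le_self _ (by positivity)) h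
          refine ⟨M', fun t ht => (hM' t ht).trans_eq ?_⟩
          congr 3
          push_cast
          ring
  have hex : ∃ a < α, ∃ M' : ℝ, ∀ t : ℝ, 0 ≤ t → ‖T t‖ ≤ M' * Real.exp (a * t) := by
    obtain ⟨n, hn⟩ := exists_nat_gt ((w₀ - α) / (δ / 2))
    rw [div_lt_iff₀ (by linarith)] at hn
    rcases hiter n with h | h
    · exact h
    · exact ⟨_, by linarith, h⟩
  obtain ⟨a, ha, M', hM'⟩ := hex
  refine lt_of_le_of_lt (sInf_le ?_) (EReal.coe_lt_coe_iff.2 ha)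
  exact ⟨a, rfl, T, hT, hAT, M', hM'⟩

end Gearhart

/-! ### Resolvents from a priori estimates -/

section

variable {E : Type*} [NormedAddCommGroup E] [NormedSpace ℂ E]

/-- The estimate gives injectivity, and the same constant bounds the algebraic inverse. -/
lemma exists_isResolventAt_of_bound {A : E →ₗ.[ℂ] E} {l : ℂ} {N : ℝ} (hN : 0 ≤ N)
    (hsurj : ∀ y : E, ∃ x : A.domain, l • (x : E) - A x = y)
    (hbound : ∀ x : A.domain, ‖(x : E)‖ ≤ N * ‖l • (x : E) - A x‖) :
    ∃ R : E →L[ℂ] E, IsResolventAt A l R ∧ ‖R‖ ≤ N := by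
  let D : A.domain →ₗ[ℂ] E := l • A.domain.subtype - A.toFun
  have hD : ∀ x : A.domain, D x = l • (x : E) - A x := fun x => rfl
  have hinj : Function.Injective D := by
    rw [← LinearMap.ker_eq_bot, LinearMap.ker_eq_bot']
    intro x hx
    have h := hbound x
    rw [← hD, hx, norm_zero, mul_zero] at h
    exact Subtype.ext (norm_le_zero_iff.1 h)
  let e : A.domain ≃ₗ[ℂ] E := LinearEquiv.ofBijective D ⟨hinj, hsurj⟩
  have he : ∀ y, l • (e.symm y : E) - A (e.symm y) = y := fun y => by
    rw [← hD]
    exact e.apply_symm_apply y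
  let R : E →L[ℂ] E := (A.domain.subtype.comp e.symm.toLinearMap).mkContinuous N fun y => by
    have h := hbound (e.symm y)
    rw [he] at h
    exact h
  refine ⟨R, ⟨fun y => ⟨(e.symm y).2, he y⟩, fun x => ?_⟩, LinearMap.mkContinuous_norm_le _ hN _⟩
  exact congrArg Subtype.val (e.symm_apply_apply x)

end

/-! ### Absolutely continuous functions and the resolvent of A₀ -/

section Primitive

variable {X : Type*} [NormedAddCommGroup X] [NormedSpace ℂ X]

/-- Increments of the vector primitive are dominated by those of the scalar primitive of ‖f‖. -/
lemma absolutelyContinuousOnInterval_integral {f : ℝ → X} {a b c : ℝ}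
    (h : IntervalIntegrable f volume a b) (hc : c ∈ uIcc a b) :
    AbsolutelyContinuousOnInterval (fun x => ∫ v in c..x, f v) a b := by
  have h1 := h.norm.absolutelyContinuousOnInterval_intervalIntegral hc
  rw [absolutelyContinuousOnInterval_iff] at h1 ⊢
  intro ε hε
  obtain ⟨δ, hδ, H⟩ := h1 ε hε
  refine ⟨δ, hδ, fun J hJ hJδ => (Finset.sum_le_sum fun i hi => ?_).trans_lt (H J hJ hJδ)⟩
  have hi' := hJ.1 i hi
  have hint : ∀ y ∈ uIcc a b, IntervalIntegrable f volume c y := fun y hy =>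
    h.mono_set (uIcc_subset_uIcc hc hy)
  rw [dist_eq_norm, Real.dist_eq,
    intervalIntegral.integral_interval_sub_left (hint _ hi'.1) (hint _ hi'.2),
    intervalIntegral.integral_interval_sub_left (hint _ hi'.1).norm (hint _ hi'.2).norm]
  exact intervalIntegral.norm_integral_le_abs_integral_norm

lemma hasDerivAt_cexp_mul (l : ℂ) (s : ℝ) :
    HasDerivAt (fun s : ℝ => Complex.exp (l * s)) (l * Complex.exp (l * s)) s := by
  have h0 : HasDerivAt (fun s : ℝ => l * (s : ℂ)) l s := by
    simpa using (Complex.ofRealCLM.hasDerivAt (x := s)).const_mul l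
  rw [mul_comm l]
  exact h0.cexp

variable [CompleteSpace X]

/-- The product rule for an exponential and an absolutely continuous function. -/
lemma exp_smul_primitive {g : ℝ → X} (hg : IntervalIntegrable g volume (-1) 0) (c : X) (l : ℂ)
    {σ : ℝ} (hσ : σ ∈ Icc (-1 : ℝ) 0) :
    Complex.exp (l * σ) • (c + ∫ s in (0 : ℝ)..σ, g s) =
      c + ∫ s in (0 : ℝ)..σ, ((l * Complex.exp (l * s)) • (c + ∫ r in (0 : ℝ)..s, g r) +
        Complex.exp (l * s) • g s) := by
  have h0 : (0 : ℝ) ∈ uIcc (-1 : ℝ) 0 := right_mem_uIcc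
  set G : ℝ → X := fun s => c + ∫ r in (0 : ℝ)..s, g r
  have hGac : AbsolutelyContinuousOnInterval G (-1) 0 :=
    ((contDiff_const (c := c)).contDiffOn.absolutelyContinuousOnInterval).add
      (absolutelyContinuousOnInterval_integral hg h0)
  have hexp : ContDiff ℝ 1 fun s : ℝ => Complex.exp (l * s) := by
    have : ContDiff ℝ 1 fun s : ℝ => (s : ℂ) := Complex.ofRealCLM.contDiff
    exact (contDiff_const.mul this).cexp
  set k : ℝ → X := fun s => (l * Complex.exp (l * s)) • G s + Complex.exp (l * s) • g s
  have hk : IntervalIntegrable k volume (-1) 0 := by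
    refine IntervalIntegrable.add ?_ (hg.continuousOn_smul hexp.continuous.continuousOn)
    refine ContinuousOn.intervalIntegrable ?_
    exact (continuous_const.mul hexp.continuous).continuousOn.smul hGac.continuousOn
  -- The difference of the two sides is absolutely continuous with derivative zero almost
  -- everywhere, hence constant; its value is read off at 0.
  have hac : AbsolutelyContinuousOnInterval
      (fun s => Complex.exp (l * s) • G s - ∫ r in (0 : ℝ)..s, k r) (-1) 0 :=
    ((hexp.contDiffOn.absolutelyContinuousOnInterval).smul hGac).sub
      (absolutelyContinuousOnInterval_integral hk h0)
  obtain ⟨C, hC⟩ := hac.const_of_ae_hasDerivAt_zero (by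
    filter_upwards [hg.ae_hasDerivAt_integral, hk.ae_hasDerivAt_integral] with s h1 h2 hs
    have d1 : HasDerivAt G (g s) s := (h1 hs 0 h0).const_add c
    have d2 := (hasDerivAt_cexp_mul l s).smul d1
    have d3 := d2.sub (h2 hs 0 h0)
    have e : Complex.exp (l * s) • g s + (l * Complex.exp (l * s)) • G s - k s = 0 := by
      simp only [k]; abel
    rw [e] at d3
    exact d3)
  have e0 := hC 0 h0
  have e1 := hC σ (by rwa [uIcc_of_le (by norm_num)])
  have hG0 : G 0 = c := by simp [G]
  simp only [intervalIntegral.integral_same, Complex.ofReal_zero, mul_zero, Complex.exp_zero,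
    one_smul, sub_zero, hG0] at e0
  rw [← e0] at e1
  exact sub_eq_iff_eq_add.1 e1

omit [CompleteSpace X] in
lemma intervalIntegral_congr_mu {f g : ℝ → X} (h : f =ᵐ[mu] g) {σ : ℝ}
    (hσ : σ ∈ Icc (-1 : ℝ) 0) : ∫ s in (0 : ℝ)..σ, f s = ∫ s in (0 : ℝ)..σ, g s := by
  refine intervalIntegral.integral_congr_ae ?_
  filter_upwards [ae_imp_of_ae_restrict h] with s hs hs'
  rw [uIoc_of_ge hσ.2] at hs'
  exact hs ⟨hσ.1.trans hs'.1.le, hs'.2⟩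

lemma IsPrimitive.exp_smul {c : X} {f g f' g' : History X} (h : IsPrimitive c f g) (l : ℂ)
    (hf' : ∀ᵐ s ∂mu, f' s = Complex.exp (l * s) • f s)
    (hg' : ∀ᵐ s ∂mu, g' s = (l * Complex.exp (l * s)) • f s + Complex.exp (l * s) • g s) :
    IsPrimitive c f' g' := by
  have e : g' =ᵐ[mu] fun s : ℝ => (l * Complex.exp (l * s)) • (c + ∫ r in (0 : ℝ)..s, g r) +
        Complex.exp (l * s) • g s := by
    filter_upwards [hg', h] with s h1 h2
    rw [h1, h2]
  filter_upwards [h, hf', ae_mem_mu] with σ h1 h2 hσ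
  rw [h2, h1, intervalIntegral_congr_mu e hσ,
    exp_smul_primitive (intervalIntegrable_coe g) c l hσ]

omit [NormedSpace ℂ X] [CompleteSpace X] in
/-- A function that is bounded by `C` has norm at most `C` in `L²([-1, 0], X)`. -/
lemma norm_history_le {f : History X} {C : ℝ} (hC : 0 ≤ C) (h : ∀ᵐ s ∂mu, ‖f s‖ ≤ C) :
    ‖f‖ ≤ C := by
  have h1 := Lp.norm_le_of_ae_bound hC h
  have h2 : measureUnivNNReal mu = 1 := by
    rw [← ENNReal.coe_inj, coe_measureUnivNNReal]
    simp
  simpa [h2] using h1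

omit [NormedSpace ℂ X] [CompleteSpace X] in
lemma integral_norm_history_le (f : History X) : ∫ s, ‖f s‖ ∂mu ≤ ‖f‖ := by
  have : IsProbabilityMeasure mu := ⟨by simp⟩
  have hf := Lp.memLp f
  rw [integral_norm_eq_lintegral_enorm hf.1, ← eLpNorm_one_eq_lintegral_enorm, Lp.norm_def]
  exact ENNReal.toReal_mono (Lp.eLpNorm_ne_top f)
    (eLpNorm_le_eLpNorm_of_exponent_le (by norm_num) hf.1)

/-- The solution of `l f - f' = h`, `f 0 = 0`. -/
lemma IsPrimitive.eq_integral {f g h : History X} (hp : IsPrimitive 0 f g) {l : ℂ}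
    (hh : l • f - g = h) : ∀ᵐ σ ∂mu,
      f σ = -(Complex.exp (l * σ) • ∫ s in (0 : ℝ)..σ, Complex.exp (-l * s) • h s) := by
  have e : (fun s : ℝ => (-l * Complex.exp (-l * s)) • (0 + ∫ r in (0 : ℝ)..s, g r) +
      Complex.exp (-l * s) • g s) =ᵐ[mu] fun s : ℝ => -(Complex.exp (-l * s) • h s) := by
    filter_upwards [hp, hh ▸ Lp.coeFn_sub (l • f) g, Lp.coeFn_smul l f] with s h1 h2 h3
    rw [← h1, h2, Pi.sub_apply, h3, Pi.smul_apply, smul_sub, smul_smul, neg_sub, neg_mul,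
      neg_smul, mul_comm l]
    abel
  filter_upwards [hp, ae_mem_mu] with σ h1 hσ
  have h2 := exp_smul_primitive (intervalIntegrable_coe g) 0 (-l) hσ
  rw [← h1, intervalIntegral_congr_mu e hσ, zero_add, intervalIntegral.integral_neg] at h2
  rw [← smul_neg, ← h2, smul_smul, ← Complex.exp_add]
  simp

-- The kernel e^{l(σ - s)} with -1 ≤ σ ≤ s ≤ 0 has modulus at most e^{|α|}, uniformly on Re l ≥ α.
omit [CompleteSpace X] in
lemma norm_le_of_integral_eq {α : ℝ} {l : ℂ} (hl : α ≤ l.re) (h : History X) {σ : ℝ}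
    (hσ : σ ∈ Icc (-1 : ℝ) 0) :
    ‖Complex.exp (l * σ) • ∫ s in (0 : ℝ)..σ, Complex.exp (-l * s) • h s‖ ≤
      Real.exp |α| * ‖h‖ := by
  have hi : IntegrableOn (fun s => ‖h s‖) (Icc (-1 : ℝ) 0) :=
    ((Lp.memLp h).integrable (by norm_num)).norm
  rw [← intervalIntegral.integral_smul, intervalIntegral.integral_symm, norm_neg,
    intervalIntegral.integral_of_le hσ.2]
  calc _ ≤ ∫ s in Ioc σ 0, Real.exp |α| * ‖h s‖ := by
        refine norm_integral_le_of_norm_le ((hi.mono_set fun s hs =>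
          ⟨hσ.1.trans hs.1.le, hs.2⟩).const_mul _) ?_
        filter_upwards [ae_restrict_mem measurableSet_Ioc] with s hs
        rw [smul_smul, norm_smul, ← Complex.exp_add, Complex.norm_exp]
        gcongr
        have e : (l * σ + -l * s).re = l.re * (σ - s) := by
          simp; ring
        rw [e]
        have h1 : l.re * (σ - s) ≤ α * (σ - s) :=
          mul_le_mul_of_nonpos_right hl (by linarith [hs.1])
        have h2 : α * (σ - s) ≤ |α| * |σ - s| := by
          rw [← abs_mul]; exact le_abs_self _
        have h3 : |σ - s| ≤ 1 := abs_le.2 ⟨by linarith [hs.2, hσ.1], by linarith [hs.1]⟩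
        nlinarith [abs_nonneg α]
    _ ≤ ∫ s in Icc (-1 : ℝ) 0, Real.exp |α| * ‖h s‖ := by
        refine setIntegral_mono_set (hi.const_mul _) (ae_of_all _ fun s => by positivity)
          (LE.le.eventuallyLE fun s hs => ⟨hσ.1.trans hs.1.le, hs.2⟩)
    _ ≤ _ := by
        rw [integral_const_mul]
        gcongr
        exact integral_norm_history_le h

lemma IsPrimitive.norm_le {f g : History X} (hp : IsPrimitive 0 f g) {α : ℝ} {l : ℂ}
    (hl : α ≤ l.re) : ‖f‖ ≤ Real.exp |α| * ‖l • f - g‖ := by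
  refine norm_history_le (by positivity) ?_
  filter_upwards [hp.eq_integral rfl, ae_mem_mu] with σ h1 hσ
  rw [h1, norm_neg]
  exact norm_le_of_integral_eq hl _ hσ

lemma norm_expTensorHistory_le {α : ℝ} {l : ℂ} (hl : α ≤ l.re) (x : X) :
    ‖expTensorHistory l x‖ ≤ Real.exp |α| * ‖x‖ := by
  refine norm_history_le (by positivity) ?_
  filter_upwards [coeFn_expTensorHistory l x, ae_mem_mu] with s h1 hs
  rw [h1, norm_smul, Complex.norm_exp]
  gcongr
  have e : (l * s).re = l.re * s := by simp
  rw [e]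
  have h1 : l.re * s ≤ α * s := mul_le_mul_of_nonpos_right hl hs.2
  have h2 : α * s ≤ |α| * |s| := by
    rw [← abs_mul]; exact le_abs_self _
  have h3 : |s| ≤ 1 := abs_le.2 ⟨hs.1, by linarith [hs.2]⟩
  nlinarith [abs_nonneg α]

lemma IsPrimitive.exists_w12 {c : X} {f g : History X} (h : IsPrimitive c f g) :
    ∃ u : W12 X, toHistory u = f ∧ derivative u = g ∧ atZero u = c :=
  ⟨⟨WithLp.toLp 2 (f, g), c, h⟩, rfl, rfl, ((isPrimitive_atZero _).unique h).1⟩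

/-- Variation of constants: f = e^{lσ} f₀ with f₀' = -e^{-lσ} h and f₀(0) = 0, so that f' = l f - h.
-/
lemma exists_smul_sub_derivative_eq (l : ℂ) (h : History X) :
    ∃ u : W12 X, atZero u = 0 ∧ l • toHistory u - derivative u = h := by
  have hcont : ∀ m : ℂ, Continuous fun s : ℝ => Complex.exp (m * s) := fun m => by fun_prop
  have hbdd : ∀ m : ℂ, ∃ C : ℝ, ∀ s ∈ Icc (-1 : ℝ) 0, ‖Complex.exp (m * s)‖ ≤ C := fun m =>
    isCompact_Icc.exists_bound_of_continuousOn (hcont m).continuousOn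
  have hmem : ∀ (m : ℂ) (k : History X), MemLp (fun s : ℝ => Complex.exp (m * s) • k s) 2 mu := by
    intro m k
    obtain ⟨C, hC⟩ := hbdd m
    refine (Lp.memLp k).of_le_mul (c := C)
      ((hcont m).aestronglyMeasurable.smul (Lp.memLp k).1) ?_
    filter_upwards [ae_mem_mu] with s hs
    rw [norm_smul]
    gcongr
    exact hC s hs
  set g₀ : History X := -(hmem (-l) h).toLp _ with hg₀
  have hg₀' : ∀ᵐ s ∂mu, g₀ s = -(Complex.exp (-l * s) • h s) := by
    filter_upwards [Lp.coeFn_neg ((hmem (-l) h).toLp _), (hmem (-l) h).coeFn_toLp] with s h1 h2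
    rw [hg₀, h1, Pi.neg_apply, h2]
  have hprim : ContinuousOn (fun σ => ∫ s in (0 : ℝ)..σ, g₀ s) (Icc (-1 : ℝ) 0) := by
    have := intervalIntegral.continuousOn_primitive_interval' (intervalIntegrable_coe g₀)
      (a := 0) (by simp [uIcc_of_le])
    rwa [uIcc_of_le (by norm_num)] at this
  have hf₀mem : MemLp (fun σ => ∫ s in (0 : ℝ)..σ, g₀ s) 2 mu := by
    obtain ⟨C, hC⟩ := isCompact_Icc.exists_bound_of_continuousOn hprim
    exact MemLp.of_bound (hprim.aestronglyMeasurable measurableSet_Icc) C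
      (by filter_upwards [ae_mem_mu] with s hs using hC s hs)
  set f₀ : History X := hf₀mem.toLp _
  have hp₀ : IsPrimitive 0 f₀ g₀ := by
    filter_upwards [hf₀mem.coeFn_toLp] with s h1
    rw [h1, zero_add]
  set f : History X := (hmem l f₀).toLp _
  have hp : IsPrimitive 0 f (l • f - h) := by
    refine hp₀.exp_smul l (hmem l f₀).coeFn_toLp ?_
    filter_upwards [(hmem l f₀).coeFn_toLp, Lp.coeFn_sub (l • f) h, Lp.coeFn_smul l f, hg₀']
      with s h1 h2 h3 h4
    rw [h2, Pi.sub_apply, h3, Pi.smul_apply, h1, h4, smul_neg, smul_smul, smul_smul,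
      ← Complex.exp_add]
    simp [sub_eq_add_neg]
  obtain ⟨u, hu1, hu2, hu3⟩ := hp.exists_w12
  exact ⟨u, hu3, by rw [hu1, hu2, sub_sub_cancel]⟩

lemma norm_toHistory_le {u : W12 X} (hu : atZero u = 0) {α : ℝ} {l : ℂ} (hl : α ≤ l.re) :
    ‖toHistory u‖ ≤ Real.exp |α| * ‖l • toHistory u - derivative u‖ :=
  IsPrimitive.norm_le (hu ▸ isPrimitive_atZero u) hl

lemma shiftGenerator_apply (x : (shiftGenerator X).domain) :
    ∃ u : W12 X, atZero u = 0 ∧ toHistory u = x ∧ shiftGenerator X x = derivative u := by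
  obtain ⟨x, u, hu, rfl⟩ := x
  refine ⟨u, hu, rfl, ?_⟩
  change derivative ((toHistoryEquiv (X := X)).symm ⟨toHistory u, _⟩) = _
  congr 1
  exact (toHistoryEquiv (X := X)).symm_apply_apply u

/-- Every point belongs to the resolvent set of `A₀`. -/
lemma exists_isResolventAt_shiftGenerator (l : ℂ) :
    ∃ R : History X →L[ℂ] History X, IsResolventAt (shiftGenerator X) l R := by
  obtain ⟨R, hR, -⟩ := exists_isResolventAt_of_bound (A := shiftGenerator X) (l := l)
    (N := Real.exp |l.re|) (Real.exp_pos _).le (fun y => by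
      obtain ⟨u, hu, hy⟩ := exists_smul_sub_derivative_eq l y
      refine ⟨⟨toHistory u, u, hu, rfl⟩, ?_⟩
      obtain ⟨v, -, hv, hv'⟩ := shiftGenerator_apply (X := X) ⟨toHistory u, u, hu, rfl⟩
      rw [hv', toHistory_injective hv, hy])
    (fun x => by
      obtain ⟨v, hv0, hv, hv'⟩ := shiftGenerator_apply x
      rw [hv', ← hv]
      exact norm_toHistory_le hv0 le_rfl)
  exact ⟨R, hR⟩

lemma resolvent_shiftGenerator {l : ℂ} {u : W12 X} (hu : atZero u = 0) :
    resolvent (shiftGenerator X) l (l • toHistory u - derivative u) = toHistory u := by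
  obtain ⟨R, hR⟩ := exists_isResolventAt_shiftGenerator (X := X) l
  obtain ⟨v, -, hv, hv'⟩ := shiftGenerator_apply (X := X) ⟨toHistory u, u, hu, rfl⟩
  have h := hR.2 ⟨toHistory u, u, hu, rfl⟩
  rw [hv', toHistory_injective hv] at h
  rw [resolvent_eq hR, h]

end Primitive

/-! ### Phragmén–Lindelöf on a half-plane -/

/-- The Phragmén–Lindelöf principle for functions of linear growth on a half-plane. -/
theorem norm_le_of_linear_growth {E : Type*} [NormedAddCommGroup E] [NormedSpace ℂ E]
    {f : ℂ → E} (hd : DiffContOnCl ℂ f {z | 0 < z.re}) {C D : ℝ}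
    (hD : ∀ z : ℂ, 0 ≤ z.re → ‖f z‖ ≤ D * (1 + ‖z‖))
    (hC : ∀ x : ℝ, ‖f (x * Complex.I)‖ ≤ C) {z : ℂ} (hz : 0 ≤ z.re) : ‖f z‖ ≤ C := by
  have hD0 : 0 ≤ D := by simpa using (norm_nonneg _).trans (hD 0 (by simp))
  have hre : ∀ {ε : ℝ} {z : ℂ}, 0 < ε → 0 ≤ z.re → 1 ≤ ‖1 + ε * z‖ := by
    intro ε z hε hz
    refine le_trans ?_ (Complex.re_le_norm _)
    have := mul_nonneg hε.le hz
    simpa using this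
  -- Damping by (1 + εz)⁻² has modulus at most 1 on Re z ≥ 0, so the boundary bound survives, and it
  -- beats linear growth along the positive axis. Then ε → 0.
  have key : ∀ ε : ℝ, 0 < ε → ‖f z‖ ≤ C * ‖1 + ε * z‖ ^ 2 := by
    intro ε hε
    have hne : ∀ {z : ℂ}, 0 ≤ z.re → (1 + ε * z) ^ 2 ≠ 0 := fun hz =>
      pow_ne_zero 2 (norm_pos_iff.1 (one_pos.trans_le (hre hε hz)))
    have hle : ∀ {z : ℂ}, 0 ≤ z.re → ‖((1 + ε * z) ^ 2)⁻¹‖ ≤ 1 := fun hz => by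
      rw [norm_inv, norm_pow]
      exact inv_le_one_of_one_le₀ (one_le_pow₀ (hre hε hz))
    have h := PhragmenLindelof.right_half_plane_of_tendsto_zero_on_real
      (f := fun z => ((1 + ε * z) ^ 2)⁻¹ • f z) (C := C) (z := z) ?_
      ⟨1, by norm_num, 1, ?_⟩ ?_ ?_ hz
    · rw [norm_smul, norm_inv, norm_pow, inv_mul_le_iff₀ (by have := hre hε hz; positivity)] at h
      rwa [mul_comm]
    · refine DiffContOnCl.smul ?_ hd
      refine DiffContOnCl.inv (Differentiable.diffContOnCl (by fun_prop)) fun z hz' => hne ?_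
      rw [Complex.closure_setOfPred_lt_re] at hz'
      exact hz'
    · refine Asymptotics.IsBigO.of_bound D ?_
      filter_upwards [mem_inf_of_right (mem_principal_self _)] with z hz
      rw [norm_smul, Real.norm_of_nonneg (Real.exp_pos _).le, one_mul, Real.rpow_one]
      calc _ ≤ 1 * (D * (1 + ‖z‖)) :=
            mul_le_mul (hle (le_of_lt hz)) (hD z (le_of_lt hz)) (norm_nonneg _) zero_le_one
        _ ≤ _ := by
            rw [one_mul, add_comm]
            gcongr
            exact Real.add_one_le_exp _
    · have hlim : Tendsto (fun x : ℝ => D * (1 + 1 / ε) * (1 + ε * x)⁻¹) atTop (𝓝 0) := by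
        have h1 : Tendsto (fun x : ℝ => 1 + ε * x) atTop atTop :=
          tendsto_atTop_add_const_left _ _ (tendsto_id.const_mul_atTop hε)
        simpa using h1.inv_tendsto_atTop.const_mul (D * (1 + 1 / ε))
      refine squeeze_zero_norm' ?_ hlim
      filter_upwards [eventually_ge_atTop (0 : ℝ)] with x hx
      have hpos : 0 < 1 + ε * x := by positivity
      have e : ‖(1 + (ε : ℂ) * x)‖ = 1 + ε * x := by
        rw [← Complex.ofReal_mul, ← Complex.ofReal_one, ← Complex.ofReal_add,
          Complex.norm_of_nonneg hpos.le]
      rw [norm_smul, norm_inv, norm_pow, e]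
      have h2 := hD x (by simpa using hx)
      rw [Complex.norm_of_nonneg hx] at h2
      have h3 : 1 + x ≤ (1 + 1 / ε) * (1 + ε * x) := by
        have : (1 + 1 / ε) * (1 + ε * x) = 1 + x + (1 / ε + ε * x) := by
          field_simp; ring
        rw [this]
        have : 0 ≤ 1 / ε + ε * x := by positivity
        linarith
      calc _ ≤ ((1 + ε * x) ^ 2)⁻¹ * (D * ((1 + 1 / ε) * (1 + ε * x))) := by
            gcongr
            exact h2.trans (mul_le_mul_of_nonneg_left h3 hD0)
        _ = _ := by field_simp
    · intro x
      rw [norm_smul]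
      exact (mul_le_mul (hle (by simp)) (hC x) (norm_nonneg _) zero_le_one).trans_eq (one_mul C)
  have hlim : Tendsto (fun ε : ℝ => C * ‖1 + (ε : ℂ) * z‖ ^ 2) (𝓝[>] 0) (𝓝 C) := by
    have : Continuous fun ε : ℝ => C * ‖1 + (ε : ℂ) * z‖ ^ 2 := by fun_prop
    have h := (this.tendsto 0).mono_left (nhdsWithin_le_nhds (s := Ioi 0))
    simpa using h
  exact ge_of_tendsto hlim (by filter_upwards [self_mem_nhdsWithin] with ε hε using key ε hε)

/-! ### Analyticity of the resolvent -/

section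

variable {E : Type*} [NormedAddCommGroup E] [NormedSpace ℂ E] [CompleteSpace E]

/-- The resolvent is analytic to the right of a growth exponent of the semigroup. -/
lemma differentiableAt_resolvent {A : E →ₗ.[ℂ] E} {T : ℝ → E →L[ℂ] E}
    (hT : IsC0Semigroup T) (hA : Generates A T) {M w : ℝ}
    (hM : ∀ t : ℝ, 0 ≤ t → ‖T t‖ ≤ M * Real.exp (w * t)) {l : ℂ} (hl : w < l.re) :
    DifferentiableAt ℂ (resolvent A) l := by
  have hres : ∀ m : ℂ, w < m.re →
      IsResolventAt A m (resolvent A m) ∧ ‖resolvent A m‖ ≤ M / (m.re - w) := by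
    intro m hm
    obtain ⟨R, hR, hRM, -⟩ := exists_isResolventAt hT hA hM hm
    rw [resolvent_eq hR]
    exact ⟨hR, hRM⟩
  -- This identity is used twice: for continuity at l, and then to identify the difference quotient
  -- with -R(m)R(l), whose limit is -R(l)².
  have hsub : ∀ m : ℂ, w < m.re → resolvent A m - resolvent A l =
      (l - m) • (resolvent A m).comp (resolvent A l) := by
    intro m hm
    ext x
    simp [(hres m hm).1.sub_eq (hres l hl).1 x]
  have hre : Tendsto (fun m : ℂ => m.re) (𝓝 l) (𝓝 l.re) := Complex.continuous_re.tendsto l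
  have hev : ∀ᶠ m in 𝓝 l, w < m.re := hre.eventually (lt_mem_nhds hl)
  have hcont : Tendsto (resolvent A) (𝓝 l) (𝓝 (resolvent A l)) := by
    rw [tendsto_iff_norm_sub_tendsto_zero]
    have hlim : Tendsto (fun m : ℂ => ‖l - m‖ * (M / (m.re - w) * ‖resolvent A l‖)) (𝓝 l)
        (𝓝 0) := by
      have h1 : Tendsto (fun m : ℂ => ‖l - m‖) (𝓝 l) (𝓝 0) := by
        have : Continuous fun m : ℂ => ‖l - m‖ := by fun_prop
        simpa using this.tendsto l
      have h2 := ((tendsto_const_nhds (x := M)).div (hre.sub_const w)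
        (sub_pos.2 hl).ne').mul_const ‖resolvent A l‖
      simpa using h1.mul h2
    refine squeeze_zero' (Eventually.of_forall fun _ => norm_nonneg _) ?_ hlim
    filter_upwards [hev] with m hm
    rw [hsub m hm, norm_smul]
    gcongr
    exact (ContinuousLinearMap.opNorm_comp_le _ _).trans
      (mul_le_mul_of_nonneg_right (hres m hm).2 (norm_nonneg _))
  refine HasDerivAt.differentiableAt (f' := -((resolvent A l).comp (resolvent A l))) ?_
  rw [hasDerivAt_iff_tendsto_slope]
  have h3 : Tendsto (fun m => -((resolvent A m).comp (resolvent A l))) (𝓝[≠] l)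
      (𝓝 (-((resolvent A l).comp (resolvent A l)))) :=
    ((((ContinuousLinearMap.compL ℂ E E E).flip (resolvent A l)).continuous.tendsto _).comp
      (hcont.mono_left nhdsWithin_le_nhds)).neg
  refine h3.congr' ?_
  filter_upwards [self_mem_nhdsWithin, nhdsWithin_le_nhds hev] with m hm hm'
  rw [slope_def_module, hsub m hm', smul_smul, ← neg_sub m l, mul_neg,
    inv_mul_cancel₀ (sub_ne_zero.2 hm), neg_one_smul]

end

/-! ### The operators Φ_l and the resolvent of the delay matrix -/

section Delay

variable {X : Type*} [NormedAddCommGroup X] [NormedSpace ℂ X] [CompleteSpace X]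

lemma atZero_expTensor (l : ℂ) (x : X) : atZero (expTensor l x) = x :=
  ((isPrimitive_atZero _).unique (isPrimitive_expTensorHistory l x)).1

lemma toHistory_expTensor (l : ℂ) (x : X) :
    toHistory (expTensor l x) = expTensorHistory l x := rfl

lemma derivative_expTensor (l : ℂ) (x : X) :
    derivative (expTensor l x) = l • expTensorHistory l x := rfl

/-- Data of an admissible delay operator: `K l = Φ R(l, A₀)`. -/
lemma Admissible.exists_apply_eq {Φ : W12 X →L[ℂ] X} (hΦ : Admissible Φ) :
    ∃ K : ℂ → History X →L[ℂ] X,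
      (∀ (l : ℂ) (u : W12 X), atZero u = 0 → K l (l • toHistory u - derivative u) = Φ u) ∧
      ∀ w : ℝ, DifferentiableOn ℂ K {l : ℂ | w < l.re} ∧
        ∃ C : ℝ, ∀ l : ℂ, w < l.re → ‖K l‖ ≤ C := by
  obtain ⟨-, K, hK, hKw⟩ := hΦ
  refine ⟨K, fun l u hu => ?_, fun w => ⟨(hKw w).1.differentiableOn, (hKw w).2⟩⟩
  obtain ⟨v, hv, hKv⟩ := hK l (l • toHistory u - derivative u)
  rw [resolvent_shiftGenerator hu] at hv
  rw [hKv, toHistory_injective hv]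

/-- The function e^{l·}x - x vanishes at 0, and l - d/dσ maps it to the constant function -l x.
Analyticity and linear growth of Φ_l are thereby inherited from K. -/
lemma phiAt_eq {Φ : W12 X →L[ℂ] X} {K : ℂ → History X →L[ℂ] X}
    (hK : ∀ (l : ℂ) (u : W12 X), atZero u = 0 → K l (l • toHistory u - derivative u) = Φ u)
    (l : ℂ) : PhiAt Φ l = PhiAt Φ 0 - l • (K l).comp (expTensorHistory 0) := by
  ext x
  have h := hK l (expTensor l x - expTensor 0 x)
    (by rw [map_sub, atZero_expTensor, atZero_expTensor, sub_self])
  have e : l • toHistory (expTensor l x - expTensor 0 x) -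
      derivative (expTensor l x - expTensor 0 x) = -(l • expTensorHistory 0 x) := by
    rw [map_sub, map_sub, toHistory_expTensor, toHistory_expTensor, derivative_expTensor,
      derivative_expTensor, zero_smul, sub_zero, smul_sub]
    abel
  rw [e, map_neg, map_smul, map_sub] at h
  change Φ (expTensor l x) = Φ (expTensor 0 x) - l • K l (expTensorHistory 0 x)
  rw [sub_eq_add_neg, h]
  abel

/-- A bound for `Φ_l R(l, B)` on a vertical line extends to the half-plane to its right. -/
theorem norm_phiAt_comp_resolvent_le {Φ : W12 X →L[ℂ] X} (hΦ : Admissible Φ)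
    {B : X →ₗ.[ℂ] X} {T : ℝ → X →L[ℂ] X} (hT : IsC0Semigroup T) (hB : Generates B T)
    {M w α q : ℝ} (hM : ∀ t : ℝ, 0 ≤ t → ‖T t‖ ≤ M * Real.exp (w * t)) (hα : w < α)
    (hq : ∀ ω : ℝ, ‖(PhiAt Φ (α + Complex.I * ω)).comp (resolvent B (α + Complex.I * ω))‖ ≤ q)
    {l : ℂ} (hl : α ≤ l.re) : ‖(PhiAt Φ l).comp (resolvent B l)‖ ≤ q := by
  obtain ⟨K, hK, hKw⟩ := hΦ.exists_apply_eq
  obtain ⟨hKd, C, hC⟩ := hKw w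
  have hM0 : 0 ≤ M := by simpa using (norm_nonneg _).trans (hM 0 le_rfl)
  have hopen : IsOpen {l : ℂ | w < l.re} := isOpen_lt continuous_const Complex.continuous_re
  have hdiff : ∀ m : ℂ, w < m.re →
      DifferentiableAt ℂ (fun m => (PhiAt Φ m).comp (resolvent B m)) m := by
    intro m hm
    have h1 : DifferentiableAt ℂ (PhiAt Φ) m := by
      rw [funext (phiAt_eq hK)]
      have h2 : DifferentiableAt ℂ K m := (hKd m hm).differentiableAt (hopen.mem_nhds hm)
      exact (differentiableAt_const _).sub
        (differentiableAt_id.smul (h2.clm_comp (differentiableAt_const _)))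
    exact h1.clm_comp (differentiableAt_resolvent hT hB hM hm)
  have hshift : ∀ z : ℂ, 0 ≤ z.re → w < ((α : ℂ) + z).re := fun z hz => by
    simp only [Complex.add_re, Complex.ofReal_re]
    linarith
  have hbound : ∀ z : ℂ, 0 ≤ z.re →
      ‖(PhiAt Φ (α + z)).comp (resolvent B (α + z))‖ ≤
        ((‖PhiAt Φ 0‖ + (1 + |α|) * (C * ‖expTensorHistory (X := X) 0‖)) * (M / (α - w))) *
          (1 + ‖z‖) := by
    intro z hz
    obtain ⟨R, hR, hRM, -⟩ := exists_isResolventAt hT hB hM (hshift z hz)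
    have hC0 : 0 ≤ C := (norm_nonneg _).trans (hC _ (hshift z hz))
    have hαw : 0 < α - w := sub_pos.2 hα
    have hR' : ‖R‖ ≤ M / (α - w) := by
      refine hRM.trans ?_
      gcongr
      simpa using hz
    have h1 : ‖PhiAt Φ (α + z)‖ ≤
        (‖PhiAt Φ 0‖ + (1 + |α|) * (C * ‖expTensorHistory (X := X) 0‖)) * (1 + ‖z‖) := by
      rw [phiAt_eq hK]
      have h2 : ‖(α : ℂ) + z‖ ≤ (1 + |α|) * (1 + ‖z‖) := by
        refine (norm_add_le _ _).trans ?_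
        rw [Complex.norm_real, Real.norm_eq_abs]
        nlinarith [abs_nonneg α, norm_nonneg z, mul_nonneg (abs_nonneg α) (norm_nonneg z)]
      have h3 : ‖((α : ℂ) + z) • (K (α + z)).comp (expTensorHistory (X := X) 0)‖ ≤
          (1 + |α|) * (1 + ‖z‖) * (C * ‖expTensorHistory (X := X) 0‖) := by
        rw [norm_smul]
        gcongr
        exact (ContinuousLinearMap.opNorm_comp_le _ _).trans
          (mul_le_mul_of_nonneg_right (hC _ (hshift z hz)) (norm_nonneg _))
      refine (norm_sub_le _ _).trans ((add_le_add_right h3 _).trans ?_)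
      nlinarith [mul_nonneg (norm_nonneg (PhiAt Φ 0)) (norm_nonneg z)]
    rw [resolvent_eq hR]
    refine (ContinuousLinearMap.opNorm_comp_le _ _).trans
      ((mul_le_mul h1 hR' (norm_nonneg _) (by positivity)).trans_eq (by ring))
  -- Translation by α moves the line Re l = α to the imaginary axis. Since w < α, the function is
  -- analytic across that line, hence continuous up to it.
  have h := norm_le_of_linear_growth
    (f := fun z : ℂ => (PhiAt Φ (α + z)).comp (resolvent B (α + z))) (z := l - α) (C := q) ?_
    hbound (fun x => by simpa [mul_comm] using hq x) (by simpa using hl)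
  · simpa using h
  · refine DifferentiableOn.diffContOnCl ?_
    rw [Complex.closure_setOfPred_lt_re]
    intro z hz
    exact ((hdiff _ (hshift z hz)).comp z ((differentiableAt_const _).add
      differentiableAt_id)).differentiableWithinAt

/-- Parametrizing the domain by u ∈ W^{1,2} avoids the identification `toHistoryEquiv` in later
computations. -/
lemma delayOperator_apply (B : X →ₗ.[ℂ] X) (Φ : W12 X →L[ℂ] X) {u : W12 X}
    (hu : atZero u ∈ B.domain) :
    ∃ h : WithLp.toLp 2 (atZero u, toHistory u) ∈ (delayOperator B Φ).domain,
      delayOperator B Φ ⟨_, h⟩ = WithLp.toLp 2 (B ⟨atZero u, hu⟩ + Φ u, derivative u) := by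
  have h : WithLp.toLp 2 (atZero u, toHistory u) ∈ delayDomain B := ⟨hu, u, rfl, rfl⟩
  refine ⟨h, ?_⟩
  have e : delayDomainSnd B ⟨_, h⟩ = u :=
    toHistory_injective (toHistory_delayDomainSnd B ⟨_, h⟩)
  change WithLp.toLp 2 (B ⟨atZero u, hu⟩ + Φ (delayDomainSnd B ⟨_, h⟩),
    derivative (delayDomainSnd B ⟨_, h⟩)) = _
  rw [e]

omit [NormedSpace ℂ X] [CompleteSpace X] in
lemma norm_toLp_le (x : X) (f : History X) :
    ‖(WithLp.toLp 2 (x, f) : StateSpace X)‖ ≤ ‖x‖ + ‖f‖ := by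
  rw [WithLp.prod_norm_eq_of_L2]
  refine Real.sqrt_le_iff.2 ⟨by positivity, ?_⟩
  change ‖x‖ ^ 2 + ‖f‖ ^ 2 ≤ _
  nlinarith [mul_nonneg (norm_nonneg x) (norm_nonneg f)]

/-- The resolvent of the delay operator matrix, for `Φ_l R(l, B)` a strict contraction. -/
theorem exists_isResolventAt_delayOperator {Φ : W12 X →L[ℂ] X} {B : X →ₗ.[ℂ] X}
    {K : ℂ → History X →L[ℂ] X}
    (hK : ∀ (l : ℂ) (u : W12 X), atZero u = 0 → K l (l • toHistory u - derivative u) = Φ u)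
    {l : ℂ} {α q N C : ℝ} (hl : α ≤ l.re) {R : X →L[ℂ] X} (hR : IsResolventAt B l R)
    (hN : ‖R‖ ≤ N) (hC : ‖K l‖ ≤ C) (hq : ‖(PhiAt Φ l).comp R‖ ≤ q) (hq1 : q < 1) :
    ∃ S : StateSpace X →L[ℂ] StateSpace X, IsResolventAt (delayOperator B Φ) l S ∧
      ‖S‖ ≤ (1 + Real.exp |α|) * (N * ((1 + C) / (1 - q))) + Real.exp |α| := by
  have hN0 : 0 ≤ N := (norm_nonneg _).trans hN
  have hC0 : 0 ≤ C := (norm_nonneg _).trans hC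
  have hq' : 0 < 1 - q := sub_pos.2 hq1
  -- Subtracting e^{l·}u(0) moves u into the domain of A₀ without changing l u - u', since l - d/dσ
  -- annihilates the exponential.
  have hdecomp : ∀ u : W12 X, atZero (u - expTensor l (atZero u)) = 0 ∧
      l • toHistory (u - expTensor l (atZero u)) - derivative (u - expTensor l (atZero u)) =
        l • toHistory u - derivative u := by
    intro u
    refine ⟨by rw [map_sub, atZero_expTensor, sub_self], ?_⟩
    rw [map_sub, map_sub, toHistory_expTensor, derivative_expTensor, smul_sub]
    abel
  have hΦu : ∀ u : W12 X,
      Φ u = PhiAt Φ l (atZero u) + K l (l • toHistory u - derivative u) := by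
    intro u
    rw [← (hdecomp u).2, hK l _ (hdecomp u).1, map_sub]
    change _ = Φ (expTensor l (atZero u)) + _
    abel
  refine exists_isResolventAt_of_bound (by positivity) (fun p => ?_) (fun p => ?_)
  · obtain ⟨u₀, hu₀, hu₀f⟩ := exists_smul_sub_derivative_eq l p.snd
    obtain ⟨S, hS⟩ := (Units.oneSub ((PhiAt Φ l).comp R) (hq.trans_lt hq1)).isUnit.exists_right_inv
    -- z plays the role of (l - B)x; S is the inverse of 1 - Φ_l R(l, B), so R z is the first
    -- component of the solution.
    set z : X := S (p.fst + K l p.snd) with hz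
    have hz1 : z - PhiAt Φ l (R z) = p.fst + K l p.snd := by
      have := congrArg (fun L : X →L[ℂ] X => L (p.fst + K l p.snd)) hS
      exact this
    obtain ⟨hy, hyz⟩ := hR.1 z
    set u : W12 X := u₀ + expTensor l (R z)
    have hu : atZero u = R z := by rw [map_add, hu₀, atZero_expTensor, zero_add]
    have huf : l • toHistory u - derivative u = p.snd := by
      rw [map_add, map_add, toHistory_expTensor, derivative_expTensor, smul_add, ← hu₀f]
      abel
    have hud : atZero u ∈ B.domain := hu ▸ hy
    obtain ⟨h, e⟩ := delayOperator_apply B Φ hud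
    refine ⟨⟨_, h⟩, ?_⟩
    rw [e]
    apply WithLp.ofLp_injective
    refine Prod.ext ?_ huf
    change l • atZero u - (B ⟨atZero u, hud⟩ + Φ u) = p.fst
    have eB : B ⟨atZero u, hud⟩ = B ⟨R z, hy⟩ := by
      congr 1
      exact Subtype.ext hu
    rw [hΦu, huf, eB, hu, ← sub_sub, hyz, ← sub_sub, hz1]
    abel
  · obtain ⟨p, hp⟩ := p
    obtain ⟨hpB, u, hu1, hu2⟩ := id hp
    have hpe : p = WithLp.toLp 2 (atZero u, toHistory u) :=
      WithLp.ofLp_injective 2 (Prod.ext hu2.symm hu1.symm)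
    subst hpe
    obtain ⟨h, e⟩ := delayOperator_apply B Φ (u := u) hpB
    set y : StateSpace X := l • WithLp.toLp 2 (atZero u, toHistory u) - delayOperator B Φ ⟨_, hp⟩
    have hy1 : y.fst = l • atZero u - (B ⟨atZero u, hpB⟩ + Φ u) := by
      change l • atZero u - (delayOperator B Φ ⟨_, hp⟩).fst = _
      rw [e]
      rfl
    have hy2 : y.snd = l • toHistory u - derivative u := by
      change l • toHistory u - (delayOperator B Φ ⟨_, hp⟩).snd = _
      rw [e]
      rfl
    have hn1 : ‖y.fst‖ ≤ ‖y‖ := WithLp.norm_fst_le _ y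
    have hn2 : ‖y.snd‖ ≤ ‖y‖ := WithLp.norm_snd_le _ y
    set z : X := l • atZero u - B ⟨atZero u, hpB⟩ with hz
    have hRz : R z = atZero u := hR.2 ⟨atZero u, hpB⟩
    have hz1 : z = PhiAt Φ l (R z) + (y.fst + K l y.snd) := by
      rw [hRz, hy1, hy2, hz, hΦu]
      abel
    -- The contraction term q ‖z‖ is absorbed on the left.
    have hzn : ‖z‖ ≤ (1 + C) / (1 - q) * ‖y‖ := by
      have h1 : ‖z‖ ≤ q * ‖z‖ + (1 + C) * ‖y‖ := by
        nth_rw 1 [hz1]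
        refine (norm_add_le _ _).trans (add_le_add ?_ ((norm_add_le _ _).trans ?_))
        · exact ((PhiAt Φ l).comp R).le_of_opNorm_le hq z
        · rw [add_mul, one_mul]
          exact add_le_add hn1 (((K l).le_of_opNorm_le hC _).trans (by gcongr))
      rw [div_mul_eq_mul_div, le_div_iff₀ hq']
      linarith
    have hyn : ‖atZero u‖ ≤ N * ((1 + C) / (1 - q)) * ‖y‖ := by
      rw [← hRz, mul_assoc]
      exact (R.le_of_opNorm_le hN z).trans (by gcongr)
    have hun : ‖toHistory u‖ ≤ Real.exp |α| * ‖y‖ + Real.exp |α| * ‖atZero u‖ := by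
      have h1 := norm_toHistory_le (hdecomp u).1 hl
      rw [(hdecomp u).2, ← hy2] at h1
      have h2 : toHistory u = toHistory (u - expTensor l (atZero u)) +
          expTensorHistory l (atZero u) := by
        rw [map_sub, toHistory_expTensor, sub_add_cancel]
      rw [h2]
      exact (norm_add_le _ _).trans (add_le_add (h1.trans (by gcongr))
        (norm_expTensorHistory_le hl _))
    refine (norm_toLp_le _ _).trans ?_
    calc _ ≤ (1 + Real.exp |α|) * ‖atZero u‖ + Real.exp |α| * ‖y‖ := by linarith
      _ ≤ (1 + Real.exp |α|) * (N * ((1 + C) / (1 - q)) * ‖y‖) + Real.exp |α| * ‖y‖ := by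
          gcongr
      _ = _ := by ring

end Delay

/-! ### The stability criterion -/

section Main

variable {X : Type*} [NormedAddCommGroup X] [InnerProductSpace ℂ X] [CompleteSpace X]

theorem growthBound_delayOperator_lt (Φ : W12 X →L[ℂ] X) (hΦ : Admissible Φ)
    (B : X →ₗ.[ℂ] X) (hB : IsGenerator B) (α : ℝ) (hα : growthBound B < (α : EReal))
    (h : (⨆ ω : ℝ, ‖(PhiAt Φ (α + Complex.I * ω)).comp
      (resolvent B (α + Complex.I * ω))‖ₑ) < 1) :
    growthBound (delayOperator B Φ) < (α : EReal) := by
  -- An exponent w < α of the semigroup of B; the same w is the abscissa used in admissibility (b).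
  obtain ⟨-, ⟨w, rfl, T, hT, hBT, M, hM⟩, hw⟩ := sInf_lt_iff.1 hα
  rw [EReal.coe_lt_coe_iff] at hw
  set s := ⨆ ω : ℝ, ‖(PhiAt Φ (α + Complex.I * ω)).comp (resolvent B (α + Complex.I * ω))‖ₑ
    with hs
  have hs_top : s ≠ ⊤ := (h.trans ENNReal.one_lt_top).ne
  have hq1 : s.toReal < 1 := by
    have := (ENNReal.toReal_lt_toReal hs_top ENNReal.one_ne_top).2 h
    simpa using this
  have hq : ∀ ω : ℝ, ‖(PhiAt Φ (α + Complex.I * ω)).comp (resolvent B (α + Complex.I * ω))‖ ≤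
      s.toReal := by
    intro ω
    rw [← toReal_enorm]
    exact ENNReal.toReal_mono hs_top (le_iSup (fun ω : ℝ =>
      ‖(PhiAt Φ (α + Complex.I * ω)).comp (resolvent B (α + Complex.I * ω))‖ₑ) ω)
  obtain ⟨K, hK, hKw⟩ := hΦ.exists_apply_eq
  obtain ⟨-, C, hC⟩ := hKw w
  refine growthBound_lt_of_resolvent_bounded (hΦ.1 B hB)
    (N := (1 + Real.exp |α|) * (M / (α - w) * ((1 + C) / (1 - s.toReal))) + Real.exp |α|)
    fun l hl => ?_
  obtain ⟨R, hR, hRM, -⟩ := exists_isResolventAt hT hBT hM (hw.trans_le hl)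
  have hM0 : 0 ≤ M := by simpa using (norm_nonneg _).trans (hM 0 le_rfl)
  refine exists_isResolventAt_delayOperator hK hl hR (N := M / (α - w)) (hRM.trans ?_)
    (hC l (hw.trans_le hl)) ?_ hq1
  · have : 0 < α - w := sub_pos.2 hw
    gcongr
  · have := norm_phiAt_comp_resolvent_le hΦ hT hBT hM hw hq hl
    rwa [resolvent_eq hR] at this

end Main

end DelayEquation

theorem mainTheorem4 {X : Type*} [NormedAddCommGroup X] [InnerProductSpace ℂ X] [CompleteSpace X]
    (Φ : DelayEquation.W12 X →L[ℂ] X) (hΦ : DelayEquation.Admissible Φ)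
    (B : X →ₗ.[ℂ] X) (hB : DelayEquation.IsGenerator B)
    (hB0 : DelayEquation.growthBound B < 0)
    (α : ℝ) (hα : DelayEquation.growthBound B < (α : EReal)) (hα0 : α ≤ 0) :
    ((⨆ ω : ℝ, ‖(DelayEquation.PhiAt Φ (α + Complex.I * ω)).comp
          (DelayEquation.resolvent B (α + Complex.I * ω))‖ₑ) < 1 →
      DelayEquation.IsGenerator (DelayEquation.delayOperator B Φ) ∧
      DelayEquation.growthBound (DelayEquation.delayOperator B Φ) < (α : EReal) ∧
      (α : EReal) ≤ 0) ∧
    ((⨆ ω : ℝ, ‖DelayEquation.PhiAt Φ (α + Complex.I * ω)‖ₑ) <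
        1 / (⨆ ω : ℝ, ‖DelayEquation.resolvent B (α + Complex.I * ω)‖ₑ) →
      DelayEquation.IsGenerator (DelayEquation.delayOperator B Φ) ∧
      DelayEquation.growthBound (DelayEquation.delayOperator B Φ) < (α : EReal) ∧
      (α : EReal) ≤ 0) := by
  have key := fun h => DelayEquation.growthBound_delayOperator_lt Φ hΦ B hB α hα h
  have hα0' : (α : EReal) ≤ 0 := by exact_mod_cast hα0
  refine ⟨fun h => ⟨hΦ.1 B hB, key h, hα0'⟩, fun h => ⟨hΦ.1 B hB, key ?_, hα0'⟩⟩
  -- Suprema are taken in [0, ∞], where 1/0 = ∞ and 1/∞ = 0, so P < 1/Q gives P Q < 1 also in the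
  -- degenerate cases.
  set P := ⨆ ω : ℝ, ‖DelayEquation.PhiAt Φ (α + Complex.I * ω)‖ₑ
  set Q := ⨆ ω : ℝ, ‖DelayEquation.resolvent B (α + Complex.I * ω)‖ₑ
  have hle : (⨆ ω : ℝ, ‖(DelayEquation.PhiAt Φ (α + Complex.I * ω)).comp
      (DelayEquation.resolvent B (α + Complex.I * ω))‖ₑ) ≤ P * Q := by
    refine iSup_le fun ω => ?_
    have h1 := le_iSup (fun ω : ℝ => ‖DelayEquation.PhiAt Φ (α + Complex.I * ω)‖ₑ) ω
    have h2 := le_iSup (fun ω : ℝ => ‖DelayEquation.resolvent B (α + Complex.I * ω)‖ₑ) ω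
    refine le_trans ?_ (mul_le_mul' h1 h2)
    rw [← ofReal_norm, ← ofReal_norm, ← ofReal_norm, ← ENNReal.ofReal_mul (norm_nonneg _)]
    exact ENNReal.ofReal_le_ofReal (ContinuousLinearMap.opNorm_comp_le _ _)
  exact hle.trans_lt (ENNReal.mul_lt_of_lt_div h)
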